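/- Let $d\ge 1$, let $\mathcal M$ be a smooth time-oriented $(d+1)$-dimensional Lorentzian manifold with boundary, let $\sigma\subset\partial\mathcal M$ be a Cauchy slice of $\partial\mathcal M$, and let $F_2:\mathcal M\to\mathbb R$ be a continuously differentiable scalar function (of either sign). Consider compact smooth spacelike codimension-one Cauchy surfaces $\Sigma\subset\mathcal M$ anchored on $\sigma$, i.e. $\partial\Sigma=\sigma=\Sigma\cap\partial\mathcal M$, given by embeddings $X:S\to\mathcal M$ of a compact $d$-manifold with boundary $S$; let $h$ be the induced metric and $$W=\int_{\Sigma} d^{d}x\,\sqrt{h}\;F_2(X),\qquad W'=\int_{\Sigma} d^{d}x\,\sqrt{h}\;|F_2(X)| .$$ Say that $\Sigma$ extremizes one of these functionals if, for every smooth one-parameter deformation $X_t:S\to\mathcal M$ of $X=X_0$ with $X_t=X$ on $\partial S$, the derivative of the functional along $X_t$ at $t=0$ exists and vanishes. Then the two functionals have the same extrema: $\Sigma$ extremizes $W$ if and only if $\Sigma$ extremizes $W'$. (In particular $W'$ is differentiable along all such deformations at an extremum of $W$, even where $F_2$ vanishes on $\Sigma$.) -/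

import Mathlib

open Set Filter Topology MeasureTheory
open scoped Manifold ContDiff

noncomputable section

namespace CauchyExtremal

/-- A smooth Lorentzian metric, of signature `(-,+,…,+)`, on a manifold with boundary `M` of
dimension `d + 1`. -/
structure LorentzianMetric (d : ℕ) (M : Type*) [TopologicalSpace M]
    [ChartedSpace (EuclideanHalfSpace (d + 1)) M] [IsManifold (𝓡∂ (d + 1)) ∞ M] where
  /-- the bilinear form on each tangent space -/
  form : ∀ x : M, TangentSpace (𝓡∂ (d + 1)) x →L[ℝ] TangentSpace (𝓡∂ (d + 1)) x →L[ℝ] ℝ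
  symm : ∀ (x : M) (v w : TangentSpace (𝓡∂ (d + 1)) x), form x v w = form x w v
  /-- there is a timelike vector, and the form is positive definite on its orthogonal complement -/
  signature : ∀ x : M, ∃ v : TangentSpace (𝓡∂ (d + 1)) x, form x v v < 0 ∧
    ∀ w : TangentSpace (𝓡∂ (d + 1)) x, w ≠ 0 → form x v w = 0 → 0 < form x w w
  contMDiff : ContMDiff (𝓡∂ (d + 1))
    ((𝓡∂ (d + 1)).prod 𝓘(ℝ, EuclideanSpace ℝ (Fin (d + 1)) →L[ℝ]
      EuclideanSpace ℝ (Fin (d + 1)) →L[ℝ] ℝ)) ∞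
    (fun x : M ↦ Bundle.TotalSpace.mk' (EuclideanSpace ℝ (Fin (d + 1)) →L[ℝ]
      EuclideanSpace ℝ (Fin (d + 1)) →L[ℝ] ℝ)
      (E := fun x : M ↦ TangentSpace (𝓡∂ (d + 1)) x →L[ℝ] TangentSpace (𝓡∂ (d + 1)) x →L[ℝ] ℝ)
      x (form x))

section Causality

variable {d : ℕ} {M : Type*} [TopologicalSpace M]
  [ChartedSpace (EuclideanHalfSpace (d + 1)) M] [IsManifold (𝓡∂ (d + 1)) ∞ M]

/-- A time orientation: a continuous timelike vector field, declared to point to the future. -/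
structure TimeOrientation (g : LorentzianMetric d M) where
  field : ∀ x : M, TangentSpace (𝓡∂ (d + 1)) x
  timelike : ∀ x : M, g.form x (field x) (field x) < 0
  continuous : Continuous
    (fun x : M ↦ (⟨x, field x⟩ : TangentBundle (𝓡∂ (d + 1)) M))

/-- `γ` restricted to the compact interval `[a, b]`, `a < b`, is a smooth future-directed timelike
curve that stays in `U`. -/
structure IsTimelikeSegment (g : LorentzianMetric d M) (T : TimeOrientation g) (U : Set M)
    (γ : ℝ → M) (a b : ℝ) : Prop where
  lt : a < b
  mapsTo : MapsTo γ (Icc a b) U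
  smooth : ContMDiffOn 𝓘(ℝ, ℝ) (𝓡∂ (d + 1)) ∞ γ (Icc a b)
  timelike : ∀ s ∈ Icc a b,
    g.form (γ s) (mfderivWithin 𝓘(ℝ, ℝ) (𝓡∂ (d + 1)) γ (Icc a b) s (1 : ℝ))
      (mfderivWithin 𝓘(ℝ, ℝ) (𝓡∂ (d + 1)) γ (Icc a b) s (1 : ℝ)) < 0
  future : ∀ s ∈ Icc a b,
    g.form (γ s) (T.field (γ s))
      (mfderivWithin 𝓘(ℝ, ℝ) (𝓡∂ (d + 1)) γ (Icc a b) s (1 : ℝ)) < 0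

/-- An inextendible piecewise smooth future-directed timelike curve in `U`. Each parameter value has
a smooth timelike segment on either side of it (so that, by compactness, break points are locally
finite); and if the curve has an end point in `U`, then no timelike curve in `U` continues it there
(such end points occur only on spacelike parts of the boundary). -/
structure IsInextendibleTimelikeCurve (g : LorentzianMetric d M) (T : TimeOrientation g)
    (U : Set M) (γ : ℝ → M) : Prop where
  right : ∀ t, ∃ b, IsTimelikeSegment g T U γ t b
  left : ∀ t, ∃ a, IsTimelikeSegment g T U γ a t
  future_inextendible : ∀ q ∈ U, Tendsto γ atTop (𝓝 q) →
    ∀ (η : ℝ → M) (a b : ℝ), IsTimelikeSegment g T U η a b → η a ≠ q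
  past_inextendible : ∀ q ∈ U, Tendsto γ atBot (𝓝 q) →
    ∀ (η : ℝ → M) (a b : ℝ), IsTimelikeSegment g T U η a b → η b ≠ q

/-- `A` is a Cauchy surface of `U`: every inextendible timelike curve of `U` meets it exactly once.
Used with `U` the whole spacetime, and with `U` its boundary. -/
def IsCauchyIn (g : LorentzianMetric d M) (T : TimeOrientation g) (U A : Set M) : Prop :=
  A ⊆ U ∧ ∀ γ : ℝ → M, IsInextendibleTimelikeCurve g T U γ → ∃! t, γ t ∈ A

end Causality

section Surfaces

variable {d : ℕ} [NeZero d] {M : Type*} [TopologicalSpace M]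
  [ChartedSpace (EuclideanHalfSpace (d + 1)) M] [IsManifold (𝓡∂ (d + 1)) ∞ M]
  {S : Type*} [TopologicalSpace S] [ChartedSpace (EuclideanHalfSpace d) S]

/-- `X : S → M`, with `S` a compact manifold with boundary of dimension `d`, is a smooth embedding
onto a spacelike codimension-one Cauchy surface of `M` anchored on `σ`: the surface meets the
boundary of `M` exactly along its own boundary, which is `σ`. (As `S` is compact and `M` Hausdorff,
an injective `X` with positive definite induced metric is an embedding.) -/
structure IsAnchoredCauchySurface (g : LorentzianMetric d M) (T : TimeOrientation g) (σ : Set M)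
    (X : S → M) : Prop where
  smooth : ContMDiff (𝓡∂ d) (𝓡∂ (d + 1)) ∞ X
  injective : Function.Injective X
  spacelike : ∀ (p : S) (v : TangentSpace (𝓡∂ d) p), v ≠ 0 →
    0 < g.form (X p) (mfderiv (𝓡∂ d) (𝓡∂ (d + 1)) X p v) (mfderiv (𝓡∂ d) (𝓡∂ (d + 1)) X p v)
  preimage_boundary : X ⁻¹' (𝓡∂ (d + 1)).boundary M = (𝓡∂ d).boundary S
  image_boundary : X '' (𝓡∂ d).boundary S = σ
  cauchy : IsCauchyIn g T univ (range X)

/-- The coordinate vector `∂X/∂xⁱ` at the point with coordinates `x` in the preferred chart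
around `c`. -/
def coordTangent (X : S → M) (c : S) (x : EuclideanSpace ℝ (Fin d)) (i : Fin d) :
    TangentSpace (𝓡∂ (d + 1)) (X ((extChartAt (𝓡∂ d) c).symm x)) :=
  mfderivWithin 𝓘(ℝ, EuclideanSpace ℝ (Fin d)) (𝓡∂ (d + 1))
    (X ∘ (extChartAt (𝓡∂ d) c).symm) (extChartAt (𝓡∂ d) c).target x
    (EuclideanSpace.single i (1 : ℝ))

/-- The matrix `hᵢⱼ = g(∂X/∂xⁱ, ∂X/∂xʲ)` of the induced metric in the preferred chart
around `c`. -/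
def inducedMetric (g : LorentzianMetric d M) (X : S → M) (c : S)
    (x : EuclideanSpace ℝ (Fin d)) : Matrix (Fin d) (Fin d) ℝ :=
  Matrix.of fun i j ↦
    g.form (X ((extChartAt (𝓡∂ d) c).symm x)) (coordTangent X c x i) (coordTangent X c x j)

/-- A smooth partition of unity on `S`, indexed by the points of `S`, the member with index `c`
being supported in the domain of the preferred chart around `c`. -/
def chartPartition (S : Type*) [TopologicalSpace S] [ChartedSpace (EuclideanHalfSpace d) S]
    [IsManifold (𝓡∂ d) ∞ S] [CompactSpace S] [T2Space S] :
    SmoothPartitionOfUnity S (𝓡∂ d) S univ :=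
  (SmoothPartitionOfUnity.exists_isSubordinate_chartAt_source (𝓡∂ d) S).choose

theorem chartPartition_isSubordinate (S : Type*) [TopologicalSpace S]
    [ChartedSpace (EuclideanHalfSpace d) S] [IsManifold (𝓡∂ d) ∞ S] [CompactSpace S] [T2Space S] :
    (chartPartition (d := d) S).IsSubordinate
      (fun c ↦ (chartAt (EuclideanHalfSpace d) c).source) :=
  (SmoothPartitionOfUnity.exists_isSubordinate_chartAt_source (𝓡∂ d) S).choose_spec

/-- The functional `∫_Σ dᵈx √h F` for the surface `Σ = X(S)`, where `F` is a scalar function on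
spacetime evaluated at the embedding `X`; as usual the integral over the compact manifold `S` is the
sum of the coordinate integrals weighted by a partition of unity (a finite sum, whose value does not
depend on the partition). -/
def surfaceFunctional [IsManifold (𝓡∂ d) ∞ S] [CompactSpace S] [T2Space S]
    (g : LorentzianMetric d M) (F : M → ℝ) (X : S → M) : ℝ :=
  ∑ᶠ c : S, ∫ x in (extChartAt (𝓡∂ d) c).target,
    chartPartition (d := d) S c ((extChartAt (𝓡∂ d) c).symm x) *
      (Real.sqrt (inducedMetric g X c x).det * F (X ((extChartAt (𝓡∂ d) c).symm x)))

/-- `Φ` is a smooth one-parameter deformation of `X` which keeps the boundary fixed. -/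
def IsVariation (d : ℕ) [NeZero d] {M : Type*} [TopologicalSpace M]
    [ChartedSpace (EuclideanHalfSpace (d + 1)) M]
    {S : Type*} [TopologicalSpace S] [ChartedSpace (EuclideanHalfSpace d) S]
    (X : S → M) (Φ : ℝ → S → M) : Prop :=
  Φ 0 = X ∧ ∃ ε > 0,
    ContMDiffOn (𝓘(ℝ, ℝ).prod (𝓡∂ d)) (𝓡∂ (d + 1)) ∞ (fun z : ℝ × S ↦ Φ z.1 z.2)
      (Ioo (-ε) ε ×ˢ univ) ∧
    ∀ t ∈ Ioo (-ε) ε, ∀ p ∈ (𝓡∂ d).boundary S, Φ t p = X p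

/-- The surface `X` extremizes `∫_Σ dᵈx √h F` under changes of the surface with fixed boundary: for
each boundary-fixing deformation the derivative of the functional at `X` exists and vanishes. -/
def Extremizes [IsManifold (𝓡∂ d) ∞ S] [CompactSpace S] [T2Space S]
    (g : LorentzianMetric d M) (F : M → ℝ) (X : S → M) : Prop :=
  ∀ Φ : ℝ → S → M, IsVariation d X Φ →
    HasDerivAt (fun t ↦ surfaceFunctional g F (Φ t)) 0 0

end Surfaces

end CauchyExtremal

end

/-!
The proof rests on one family of deformations. If `Φ` is a deformation of the surface `X` and `ψ` is
a smooth function on `S`, then `(t, p) ↦ Φ (t ψ(p)) p` is again a deformation of `X`, with velocity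
multiplied by `ψ` (`IsVariation.reparametrize`). Write `f = F₂ ∘ X`, let `v` be the time derivative
of `F₂` along `Φ`, and let `√h` be the area density. The first variation of `∫ √h F₂` along this
family has the form `A(ψ) = ∑ ∫ (ψ a + f b(dψ))`, a sum over charts in which `a` restricts to `√h v`
on the zero set of `f`; the derivative of `ψ` enters only through the area density, hence with the
factor `f`. For `|F₂|` only one-sided derivatives exist a priori, and by dominated convergence the
right derivative is `B(ψ) + ∫_{f = 0} √h |ψ v|`, where `B` is obtained from `A` by multiplying the
coefficients by `sign f`
(`IsSpacelikeDeformation.hasDerivWithinAt_surfaceFunctional_abs`); the left derivative is minus the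
right derivative for `-ψ`.

The key is `testFunctional_sign_eq_zero`: if a functional of the form of `A` vanishes for all smooth
`ψ`, it still does after its coefficients are multiplied by `sign f`. Indeed one may test with
`ψ · arctan (N u)`, with `u` a smooth approximation of `f` that depends on `N`; the derivative of
the second factor contributes `f N / (1 + N² u²) b(du)`, which stays bounded and tends to zero. The
function `f` being only continuously differentiable, the approximations have to be uniform with
bounded differentials; they come from mollifying Lipschitz extensions in charts
(`exists_contMDiff_dist_le_norm_chartDeriv_le`).

If `X` extremizes `∫ √h F₂`, then `A` vanishes, hence so do `B` and the functional `C` with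
coefficients multiplied by `(sign f)²`. The difference `A(ψ) - C(ψ)` is `∫_{f = 0} √h ψ v`, so `v`
vanishes almost everywhere on the zero set of `f`, and the derivative for `|F₂|` is zero.
Conversely, if `X` extremizes `∫ √h |F₂|`, comparing `ψ = 1` with `ψ = -1` shows that `v` vanishes almost
everywhere on the zero set of `f`; then `B` vanishes, hence so does `C`, which now equals `A`.
-/

open scoped Convolution NNReal

noncomputable section

namespace CauchyExtremal

/-! ### Smoothing Lipschitz and continuously differentiable functions -/

/-- Mollification: a real Lipschitz function on a Euclidean space is a uniform limit of smooth
functions with the same Lipschitz constant. -/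
theorem exists_contDiff_lipschitzWith_dist_le {d : ℕ} {L : ℝ≥0}
    {u : EuclideanSpace ℝ (Fin d) → ℝ} (hu : LipschitzWith L u) {δ : ℝ} (hδ : 0 < δ) :
    ∃ w : EuclideanSpace ℝ (Fin d) → ℝ,
      ContDiff ℝ ∞ w ∧ LipschitzWith L w ∧ ∀ x, |w x - u x| ≤ δ := by
  set r : ℝ := δ / (L + 1) with hr
  have hL : (0 : ℝ) < L + 1 := by positivity
  have hr0 : 0 < r := by positivity
  let φ : ContDiffBump (0 : EuclideanSpace ℝ (Fin d)) := ⟨r / 2, r, by positivity, by linarith⟩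
  have hint : ∀ x, Integrable (fun t ↦ φ.normed volume t * u (x - t)) := fun x ↦
    ((φ.continuous_normed).mul
      (hu.continuous.comp (continuous_const.sub continuous_id))).integrable_of_hasCompactSupport
      (φ.hasCompactSupport_normed.mul_right)
  have hφ : Integrable (φ.normed (volume : Measure (EuclideanSpace ℝ (Fin d)))) :=
    φ.integrable_normed
  refine ⟨φ.normed volume ⋆[ContinuousLinearMap.lsmul ℝ ℝ, volume] u, ?_, ?_, ?_⟩
  · exact HasCompactSupport.contDiff_convolution_left _ φ.hasCompactSupport_normed
      φ.contDiff_normed hu.continuous.locallyIntegrable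
  · refine LipschitzWith.of_dist_le_mul fun x y ↦ ?_
    rw [convolution_def, convolution_def]
    simp only [ContinuousLinearMap.lsmul_apply, smul_eq_mul]
    rw [dist_eq_norm, ← integral_sub (hint x) (hint y)]
    calc ‖∫ t, (φ.normed volume t * u (x - t) - φ.normed volume t * u (y - t))‖
        ≤ ∫ t, φ.normed volume t * (L * dist x y) := by
          refine norm_integral_le_of_norm_le (hφ.mul_const _) (ae_of_all _ fun t ↦ ?_)
          rw [← mul_sub, norm_mul, Real.norm_of_nonneg (φ.nonneg_normed t)]
          refine mul_le_mul_of_nonneg_left ?_ (φ.nonneg_normed t)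
          have := hu.dist_le_mul (x - t) (y - t)
          rwa [dist_sub_right, dist_eq_norm] at this
      _ = L * dist x y := by
          rw [integral_mul_const, φ.integral_normed, one_mul]
  · intro x
    rw [← Real.dist_eq]
    refine ContDiffBump.dist_normed_convolution_le hu.continuous.aestronglyMeasurable
      fun y hy ↦ (hu.dist_le_mul y x).trans ?_
    have : dist y x ≤ r := (Metric.mem_ball.1 hy).le
    calc (L : ℝ) * dist y x ≤ (L + 1) * r := by gcongr; linarith
      _ = δ := by rw [hr]; field_simp

section Charts

variable {d : ℕ} [NeZero d] {S : Type*} [TopologicalSpace S] [ChartedSpace (EuclideanHalfSpace d) S]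

/-- The differential of a function on `S` in the preferred chart around `c`, at the point with
coordinates `x`. -/
def chartDeriv (c : S) (ψ : S → ℝ) (x : EuclideanSpace ℝ (Fin d)) :
    EuclideanSpace ℝ (Fin d) →L[ℝ] ℝ :=
  fderivWithin ℝ (ψ ∘ (extChartAt (𝓡∂ d) c).symm) (extChartAt (𝓡∂ d) c).target x

theorem contDiffOn_comp_extChartAt_symm [IsManifold (𝓡∂ d) ∞ S] {F : Type*}
    [NormedAddCommGroup F] [NormedSpace ℝ F] {n : ℕ∞} {ψ : S → F}
    (hψ : ContMDiff (𝓡∂ d) 𝓘(ℝ, F) n ψ) (c : S) :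
    ContDiffOn ℝ n (ψ ∘ (extChartAt (𝓡∂ d) c).symm) (extChartAt (𝓡∂ d) c).target := by
  have : IsManifold (𝓡∂ d) n S := IsManifold.of_le (n := ∞) (by exact_mod_cast le_top)
  exact contMDiffOn_iff_contDiffOn.1 (hψ.comp_contMDiffOn (contMDiffOn_extChartAt_symm c))

theorem hasFDerivWithinAt_chartDeriv [IsManifold (𝓡∂ d) ∞ S] {n : ℕ∞} (hn : 1 ≤ n) {ψ : S → ℝ}
    (hψ : ContMDiff (𝓡∂ d) 𝓘(ℝ, ℝ) n ψ) (c : S) {x : EuclideanSpace ℝ (Fin d)}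
    (hx : x ∈ (extChartAt (𝓡∂ d) c).target) :
    HasFDerivWithinAt (ψ ∘ (extChartAt (𝓡∂ d) c).symm) (chartDeriv c ψ x)
      (extChartAt (𝓡∂ d) c).target x :=
  ((contDiffOn_comp_extChartAt_symm hψ c).differentiableOn
    (by exact_mod_cast (zero_lt_one.trans_le hn).ne') x hx).hasFDerivWithinAt

theorem chartDeriv_eq_of_hasFDerivWithinAt {c : S} {ψ : S → ℝ} {x : EuclideanSpace ℝ (Fin d)}
    {ψ' : EuclideanSpace ℝ (Fin d) →L[ℝ] ℝ} (hx : x ∈ (extChartAt (𝓡∂ d) c).target)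
    (h : HasFDerivWithinAt (ψ ∘ (extChartAt (𝓡∂ d) c).symm) ψ' (extChartAt (𝓡∂ d) c).target x) :
    chartDeriv c ψ x = ψ' :=
  h.fderivWithin (uniqueDiffOn_extChartAt_target c x hx)

theorem contDiffOn_chartDeriv [IsManifold (𝓡∂ d) ∞ S] {ψ : S → ℝ}
    (hψ : ContMDiff (𝓡∂ d) 𝓘(ℝ, ℝ) ∞ ψ) (c : S) :
    ContDiffOn ℝ ∞ (chartDeriv c ψ) (extChartAt (𝓡∂ d) c).target :=
  (contDiffOn_comp_extChartAt_symm (n := ⊤) hψ c).fderivWithin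
    (uniqueDiffOn_extChartAt_target c) (by simp)

theorem measurableSet_extChartAt_target (c : S) : MeasurableSet (extChartAt (𝓡∂ d) c).target := by
  rw [extChartAt_target]
  exact (((chartAt (EuclideanHalfSpace d) c).open_target.preimage
    (𝓡∂ d).continuous_symm).measurableSet).inter (𝓡∂ d).isClosed_range.measurableSet

variable [IsManifold (𝓡∂ d) ∞ S] [CompactSpace S] [T2Space S]

/-- The compact set of coordinates, in the preferred chart around `c`, of the points in the support
of the member of the partition of unity with index `c`. -/
def chartSupport (c : S) : Set (EuclideanSpace ℝ (Fin d)) :=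
  extChartAt (𝓡∂ d) c '' tsupport (chartPartition (d := d) S c)

theorem tsupport_chartPartition_subset (c : S) :
    tsupport (chartPartition (d := d) S c) ⊆ (extChartAt (𝓡∂ d) c).source := by
  rw [extChartAt_source]
  exact chartPartition_isSubordinate S c

theorem isCompact_chartSupport (c : S) : IsCompact (chartSupport (d := d) c) :=
  (isClosed_tsupport _).isCompact.image_of_continuousOn
    ((continuousOn_extChartAt c).mono (tsupport_chartPartition_subset c))

theorem chartSupport_subset (c : S) :
    chartSupport (d := d) c ⊆ (extChartAt (𝓡∂ d) c).target := by
  rintro _ ⟨p, hp, rfl⟩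
  exact (extChartAt (𝓡∂ d) c).map_source (tsupport_chartPartition_subset c hp)

theorem chartPartition_symm_eq_zero {c : S} {x : EuclideanSpace ℝ (Fin d)}
    (hx : x ∈ (extChartAt (𝓡∂ d) c).target) (hx' : x ∉ chartSupport (d := d) c) :
    chartPartition (d := d) S c ((extChartAt (𝓡∂ d) c).symm x) = 0 := by
  by_contra h
  exact hx' ⟨_, subset_tsupport _ h, (extChartAt (𝓡∂ d) c).right_inv hx⟩

variable (d S) in
theorem finite_support_chartPartition :
    {c : S | (Function.support (chartPartition (d := d) S c)).Nonempty}.Finite :=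
  (chartPartition (d := d) S).locallyFinite.finite_nonempty_of_compact

variable (d S) in
/-- The indices of the members of the partition of unity that do not vanish identically. -/
def partitionIndex : Finset S := (finite_support_chartPartition d S).toFinset

theorem chartPartition_eq_zero {c : S} (hc : c ∉ partitionIndex d S) (p : S) :
    chartPartition (d := d) S c p = 0 := by
  by_contra h
  exact hc ((finite_support_chartPartition d S).mem_toFinset.2 ⟨p, h⟩)

theorem sum_chartPartition (p : S) :
    ∑ c ∈ partitionIndex d S, chartPartition (d := d) S c p = 1 := by
  rw [← (chartPartition (d := d) S).sum_eq_one (mem_univ p)]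
  refine (finsum_eq_sum_of_support_subset _ fun c hc ↦ ?_).symm
  by_contra h
  exact hc (chartPartition_eq_zero h p)

/-- The preferred chart around `c`, cut off to a map on all of `S` that is smooth and agrees with
the chart on the support of the member of the partition of unity with index `c`. -/
theorem exists_contMDiff_eqOn_extChartAt (c : S) :
    ∃ ξ : S → EuclideanSpace ℝ (Fin d), ContMDiff (𝓡∂ d) 𝓘(ℝ, EuclideanSpace ℝ (Fin d)) ∞ ξ ∧
      EqOn ξ (extChartAt (𝓡∂ d) c) (tsupport (chartPartition (d := d) S c)) := by
  obtain ⟨u, huo, hsu, hus⟩ := normal_exists_closure_subset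
    (isClosed_tsupport (chartPartition (d := d) S c)) (isOpen_extChartAt_source (I := 𝓡∂ d) c)
    (tsupport_chartPartition_subset c)
  obtain ⟨χ, hχ1, hχ0, -⟩ := exists_contMDiffMap_one_nhds_of_subset_interior (𝓡∂ d) (n := ⊤)
    (isClosed_tsupport (chartPartition (d := d) S c)) (hsu.trans huo.interior_eq.symm.subset)
  refine ⟨fun p ↦ χ p • extChartAt (𝓡∂ d) c p, contMDiff_of_tsupport fun p hp ↦ ?_, fun p hp ↦ ?_⟩
  · have hpu : p ∈ closure u := by
      refine closure_mono (fun q hq ↦ ?_) hp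
      by_contra hqu
      exact hq (by simp [hχ0 q hqu])
    exact χ.contMDiff.contMDiffAt.smul
      (contMDiffAt_extChartAt' (by simpa only [extChartAt_source] using hus hpu))
  · simp [hχ1.self_of_nhdsSet p hp]

theorem exists_lipschitzOnWith_chartSupport {f : S → ℝ} (hf : ContMDiff (𝓡∂ d) 𝓘(ℝ, ℝ) 1 f)
    (c : S) : ∃ L : ℝ≥0,
      LipschitzOnWith L (f ∘ (extChartAt (𝓡∂ d) c).symm) (chartSupport (d := d) c) := by
  refine LocallyLipschitzOn.exists_lipschitzOnWith_of_compact (isCompact_chartSupport c)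
    fun x hx ↦ ?_
  have hxt := chartSupport_subset c hx
  have hnhds : 𝓝[(extChartAt (𝓡∂ d) c).target] x = 𝓝[range (𝓡∂ d)] x :=
    nhdsWithin_extChartAt_target_eq_of_mem hxt
  have h1 : ContDiffWithinAt ℝ 1 (f ∘ (extChartAt (𝓡∂ d) c).symm) (range (𝓡∂ d)) x :=
    ((contDiffOn_comp_extChartAt_symm (n := 1) hf c) x hxt).mono_of_mem_nhdsWithin
      (hnhds ▸ self_mem_nhdsWithin)
  obtain ⟨L, t, ht, hL⟩ := h1.exists_lipschitzOnWith (𝓡∂ d).convex_range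
  refine ⟨L, t, nhdsWithin_mono x ?_ ht, hL⟩
  exact (chartSupport_subset c).trans (extChartAt_target_subset_range c)

/-- A continuously differentiable function on `S` is a uniform limit of smooth functions whose
differentials in the charts stay bounded. -/
theorem exists_contMDiff_dist_le_norm_chartDeriv_le {f : S → ℝ}
    (hf : ContMDiff (𝓡∂ d) 𝓘(ℝ, ℝ) 1 f) : ∃ C : S → ℝ, ∀ δ > 0, ∃ u : S → ℝ,
      ContMDiff (𝓡∂ d) 𝓘(ℝ, ℝ) ∞ u ∧ (∀ p, |u p - f p| ≤ δ) ∧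
      ∀ c, ∀ x ∈ chartSupport (d := d) c, ‖chartDeriv c u x‖ ≤ C c := by
  choose ξ hξ hξeq using exists_contMDiff_eqOn_extChartAt (d := d) (S := S)
  choose L hL using exists_lipschitzOnWith_chartSupport hf
  choose g hg hgeq using fun a ↦ (hL a).extend_real
  have hbound : ∀ {F : Type} [NormedAddCommGroup F] [NormedSpace ℝ F] (η : S → F),
      ContMDiff (𝓡∂ d) 𝓘(ℝ, F) ∞ η → ∀ c : S, ∃ C, ∀ x ∈ chartSupport (d := d) c,
        ‖fderivWithin ℝ (η ∘ (extChartAt (𝓡∂ d) c).symm) (extChartAt (𝓡∂ d) c).target x‖ ≤ C := by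
    intro F _ _ η hη c
    exact (isCompact_chartSupport c).exists_bound_of_continuousOn
      (((contDiffOn_comp_extChartAt_symm (n := ⊤) hη c).continuousOn_fderivWithin
        (uniqueDiffOn_extChartAt_target c) (by simp)).mono (chartSupport_subset c))
  choose R hR using fun a ↦ hbound (chartPartition (d := d) S a)
    (chartPartition (d := d) S a).contMDiff
  choose T hT using fun a ↦ hbound (ξ a) (hξ a)
  have hgb : ∀ a, ∃ B, ∀ p : S, |g a (ξ a p)| ≤ B := fun a ↦ by
    obtain ⟨B, hB⟩ := isCompact_univ.exists_bound_of_continuousOn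
      ((hg a).continuous.comp (hξ a).continuous).continuousOn
    exact ⟨B, fun p ↦ hB p (mem_univ p)⟩
  choose B hB using hgb
  refine ⟨fun c ↦ ∑ a ∈ partitionIndex d S, ((B a + 1) * R a c + L a * T a c), fun δ hδ ↦ ?_⟩
  have hδ' : 0 < min δ 1 := by positivity
  choose w hw hwL hwd using fun a ↦ exists_contDiff_lipschitzWith_dist_le (hg a) hδ'
  have hterm : ∀ a, ContMDiff (𝓡∂ d) 𝓘(ℝ, ℝ) ∞
      (fun p ↦ chartPartition (d := d) S a p * w a (ξ a p)) := fun a ↦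
    (chartPartition (d := d) S a).contMDiff.mul ((hw a).contMDiff.comp (hξ a))
  refine ⟨fun p ↦ ∑ a ∈ partitionIndex d S, chartPartition (d := d) S a p * w a (ξ a p),
    contMDiff_finsetSum fun a _ ↦ hterm a, fun p ↦ ?_, fun c x hx ↦ ?_⟩
  · have h1 : f p = ∑ a ∈ partitionIndex d S, chartPartition (d := d) S a p * f p := by
      rw [← Finset.sum_mul, sum_chartPartition, one_mul]
    rw [h1, ← Finset.sum_sub_distrib]
    calc |∑ a ∈ partitionIndex d S, (chartPartition (d := d) S a p * w a (ξ a p) -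
            chartPartition (d := d) S a p * f p)|
        ≤ ∑ a ∈ partitionIndex d S, chartPartition (d := d) S a p * δ := by
          refine (Finset.abs_sum_le_sum_abs _ _).trans (Finset.sum_le_sum fun a _ ↦ ?_)
          rw [← mul_sub, abs_mul, abs_of_nonneg ((chartPartition (d := d) S).nonneg a p)]
          rcases eq_or_ne (chartPartition (d := d) S a p) 0 with h0 | h0
          · simp [h0]
          refine mul_le_mul_of_nonneg_left ?_ ((chartPartition (d := d) S).nonneg a p)
          have hp : p ∈ tsupport (chartPartition (d := d) S a) := subset_tsupport _ h0
          have hfg : f p = g a (ξ a p) := by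
            rw [hξeq a hp, ← hgeq a ⟨p, hp, rfl⟩, Function.comp_apply,
              (extChartAt (𝓡∂ d) a).left_inv (tsupport_chartPartition_subset a hp)]
          rw [hfg]
          exact (hwd a _).trans (min_le_left _ _)
      _ = δ := by rw [← Finset.sum_mul, sum_chartPartition, one_mul]
  · have hxt := chartSupport_subset c hx
    have hd : ∀ a, HasFDerivWithinAt
        ((fun p ↦ chartPartition (d := d) S a p * w a (ξ a p)) ∘ (extChartAt (𝓡∂ d) c).symm)
        (chartDeriv c (fun p ↦ chartPartition (d := d) S a p * w a (ξ a p)) x)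
        (extChartAt (𝓡∂ d) c).target x := fun a ↦
      hasFDerivWithinAt_chartDeriv (n := ⊤) le_top (hterm a) c hxt
    have hsum : chartDeriv c
        (fun p ↦ ∑ a ∈ partitionIndex d S, chartPartition (d := d) S a p * w a (ξ a p)) x =
        ∑ a ∈ partitionIndex d S,
          chartDeriv c (fun p ↦ chartPartition (d := d) S a p * w a (ξ a p)) x :=
      chartDeriv_eq_of_hasFDerivWithinAt hxt (HasFDerivWithinAt.fun_sum fun a _ ↦ hd a)
    rw [hsum]
    refine (norm_sum_le _ _).trans (Finset.sum_le_sum fun a _ ↦ ?_)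
    have hr := hasFDerivWithinAt_chartDeriv (n := ⊤) le_top
      (chartPartition (d := d) S a).contMDiff c hxt
    have hξ' := ((contDiffOn_comp_extChartAt_symm (n := ⊤) (hξ a) c).differentiableOn
      (by simp) x hxt).hasFDerivWithinAt
    have hw' := ((hw a).differentiable (by simp)
      (ξ a ((extChartAt (𝓡∂ d) c).symm x))).hasFDerivAt.comp_hasFDerivWithinAt x hξ'
    have hprod := chartDeriv_eq_of_hasFDerivWithinAt hxt
      (ψ := fun p ↦ chartPartition (d := d) S a p * w a (ξ a p)) (hr.mul hw')
    rw [hprod]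
    have hw1 : |w a (ξ a ((extChartAt (𝓡∂ d) c).symm x))| ≤ B a + 1 := by
      have h1 := hwd a (ξ a ((extChartAt (𝓡∂ d) c).symm x))
      have h2 := hB a ((extChartAt (𝓡∂ d) c).symm x)
      have h3 := min_le_right δ 1
      rw [abs_le] at *
      constructor <;> linarith
    have hρ1 : ‖chartPartition (d := d) S a ((extChartAt (𝓡∂ d) c).symm x)‖ ≤ 1 := by
      rw [Real.norm_of_nonneg ((chartPartition (d := d) S).nonneg a _)]
      exact (chartPartition (d := d) S).le_one a _
    have hT0 : 0 ≤ T a c := (norm_nonneg _).trans (hT a c x hx)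
    refine (norm_add_le _ _).trans ?_
    rw [add_comm, norm_smul, norm_smul]
    refine add_le_add ?_ ?_
    · exact mul_le_mul hw1 (hR a c x hx) (norm_nonneg _) ((abs_nonneg _).trans hw1)
    · calc _ ≤ 1 * (L a * T a c) := by
            refine mul_le_mul hρ1 ((ContinuousLinearMap.opNorm_comp_le _ _).trans ?_)
              (norm_nonneg _) zero_le_one
            exact mul_le_mul (norm_fderiv_le_of_lipschitz ℝ (hwL a)) (hT a c x hx)
              (norm_nonneg _) (NNReal.coe_nonneg _)
        _ = _ := one_mul _

end Charts

/-! ### Bounded coefficients on compact sets -/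

/-- `u` is almost everywhere strongly measurable and bounded on `K`. -/
structure IsBoundedOn {E : Type*} [MeasureSpace E] {F : Type*} [NormedAddCommGroup F]
    (u : E → F) (K : Set E) : Prop where
  aestronglyMeasurable : AEStronglyMeasurable u (volume.restrict K)
  exists_bound : ∃ C, ∀ x ∈ K, ‖u x‖ ≤ C

namespace IsBoundedOn

variable {E : Type*} [MeasureSpace E] {F : Type*} [NormedAddCommGroup F] {K : Set E}

theorem const (v : F) : IsBoundedOn (fun _ : E ↦ v) K :=
  ⟨aestronglyMeasurable_const, ‖v‖, fun _ _ ↦ le_rfl⟩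

theorem add {u w : E → F} (hu : IsBoundedOn u K) (hw : IsBoundedOn w K) :
    IsBoundedOn (fun x ↦ u x + w x) K := by
  obtain ⟨C, hC⟩ := hu.exists_bound
  obtain ⟨D, hD⟩ := hw.exists_bound
  exact ⟨hu.1.add hw.1, C + D, fun x hx ↦ (norm_add_le _ _).trans (add_le_add (hC x hx) (hD x hx))⟩

theorem smul [NormedSpace ℝ F] {u : E → ℝ} {w : E → F} (hu : IsBoundedOn u K)
    (hw : IsBoundedOn w K) : IsBoundedOn (fun x ↦ u x • w x) K := by
  obtain ⟨C, hC⟩ := hu.exists_bound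
  obtain ⟨D, hD⟩ := hw.exists_bound
  refine ⟨hu.1.smul hw.1, C * D, fun x hx ↦ ?_⟩
  rw [norm_smul]
  exact mul_le_mul (hC x hx) (hD x hx) (norm_nonneg _) ((norm_nonneg _).trans (hC x hx))

theorem mul {u w : E → ℝ} (hu : IsBoundedOn u K) (hw : IsBoundedOn w K) :
    IsBoundedOn (fun x ↦ u x * w x) K := hu.smul hw

theorem clm_apply {V : Type*} [NormedAddCommGroup V] [NormedSpace ℝ V] [NormedSpace ℝ F]
    {u : E → V →L[ℝ] F} {w : E → V} (hu : IsBoundedOn u K) (hw : IsBoundedOn w K) :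
    IsBoundedOn (fun x ↦ u x (w x)) K := by
  obtain ⟨C, hC⟩ := hu.exists_bound
  obtain ⟨D, hD⟩ := hw.exists_bound
  refine ⟨?_, C * D, fun x hx ↦ ?_⟩
  · exact (ContinuousLinearMap.apply ℝ F).aestronglyMeasurable_comp₂ hw.1 hu.1
  · exact ((u x).le_opNorm _).trans (mul_le_mul (hC x hx) (hD x hx) (norm_nonneg _)
      ((norm_nonneg _).trans (hC x hx)))

theorem integrableOn [TopologicalSpace E] [IsFiniteMeasureOnCompacts (volume : Measure E)]
    {u : E → F} (hu : IsBoundedOn u K) (hK : IsCompact K) (hKm : MeasurableSet K) :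
    IntegrableOn u K := by
  obtain ⟨C, hC⟩ := hu.exists_bound
  have : IsFiniteMeasure (volume.restrict K) := ⟨by simpa using hK.measure_lt_top⟩
  exact Integrable.of_bound hu.1 C ((ae_restrict_iff' hKm).2 (ae_of_all _ hC))

end IsBoundedOn

theorem _root_.ContinuousOn.isBoundedOn {E : Type*} [MeasureSpace E] [TopologicalSpace E]
    [OpensMeasurableSpace E] [SecondCountableTopology E] [TopologicalSpace.PseudoMetrizableSpace E]
    {F : Type*} [NormedAddCommGroup F] {K : Set E}
    {u : E → F} (hu : ContinuousOn u K) (hK : IsCompact K) (hKm : MeasurableSet K) :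
    IsBoundedOn u K :=
  ⟨hu.aestronglyMeasurable_of_isCompact hK hKm, hK.exists_bound_of_continuousOn hu⟩

theorem measurable_real_sign : Measurable Real.sign :=
  Measurable.ite measurableSet_Iio measurable_const
    (Measurable.ite measurableSet_Ioi measurable_const measurable_const)

theorem abs_real_sign_le_one (y : ℝ) : |Real.sign y| ≤ 1 := by
  rcases Real.sign_apply_eq y with h | h | h <;> simp [h]

theorem IsBoundedOn.real_sign {E : Type*} [MeasureSpace E] {K : Set E} {u : E → ℝ}
    (hu : IsBoundedOn u K) : IsBoundedOn (fun x ↦ Real.sign (u x)) K :=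
  ⟨(measurable_real_sign.comp_aemeasurable hu.1.aemeasurable).aestronglyMeasurable, 1,
    fun x _ ↦ abs_real_sign_le_one (u x)⟩

/-! ### Truncating the test function by the sign of the integrand -/

/-- The smoothed sign function `y ↦ arctan (N y)`, evaluated along an approximation `z N` of `y`
that is much better than `1 / N`. -/
theorem tendsto_arctan_mul_approx {y : ℝ} {z : ℕ → ℝ}
    (hz : ∀ n : ℕ, |z n - y| ≤ 1 / ((n : ℝ) + 1) ^ 2) :
    Tendsto (fun n : ℕ ↦ Real.arctan (((n : ℝ) + 1) * z n)) atTop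
      (𝓝 (Real.pi / 2 * Real.sign y)) := by
  have hN : Tendsto (fun n : ℕ ↦ (n : ℝ) + 1) atTop atTop :=
    tendsto_atTop_add_const_right _ _ tendsto_natCast_atTop_atTop
  have herr : Tendsto (fun n : ℕ ↦ ((n : ℝ) + 1) * (z n - y)) atTop (𝓝 0) := by
    refine squeeze_zero_norm (fun n ↦ ?_) (tendsto_inv_atTop_zero.comp hN)
    have h0 : (0 : ℝ) < n + 1 := by positivity
    rw [norm_mul, Real.norm_of_nonneg h0.le]
    calc ((n : ℝ) + 1) * ‖z n - y‖ ≤ (n + 1) * (1 / ((n : ℝ) + 1) ^ 2) := by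
          gcongr; exact hz n
      _ = ((n : ℝ) + 1)⁻¹ := by field_simp
  have hsplit : ∀ n : ℕ, ((n : ℝ) + 1) * z n = ((n : ℝ) + 1) * y + ((n : ℝ) + 1) * (z n - y) :=
    fun n ↦ by ring
  rcases lt_trichotomy y 0 with hy | rfl | hy
  · have h : Tendsto (fun n : ℕ ↦ ((n : ℝ) + 1) * z n) atTop atBot := by
      simp_rw [hsplit]
      exact (hN.atTop_mul_const_of_neg hy).atBot_add herr
    have := (Real.tendsto_arctan_atBot.mono_right nhdsWithin_le_nhds).comp h
    simpa [Real.sign_of_neg hy, neg_div, Function.comp_def] using this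
  · have h : Tendsto (fun n : ℕ ↦ ((n : ℝ) + 1) * z n) atTop (𝓝 0) := by
      simpa using herr
    simpa [Function.comp_def] using (Real.continuous_arctan.tendsto 0).comp h
  · have h : Tendsto (fun n : ℕ ↦ ((n : ℝ) + 1) * z n) atTop atTop := by
      simp_rw [hsplit]
      exact (hN.atTop_mul_const hy).atTop_add herr
    have := (Real.tendsto_arctan_atTop.mono_right nhdsWithin_le_nhds).comp h
    simpa [Real.sign_of_pos hy, Function.comp_def] using this

/-- The factor that multiplies the differential of the approximation `z` of `y` when
`arctan (N z)` is differentiated and the result multiplied by `y`. -/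
theorem abs_mul_div_one_add_sq_le {y z N : ℝ} (hN : 1 ≤ N) (hz : |z - y| ≤ 1 / N ^ 2) :
    |y * (N / (1 + (N * z) ^ 2))| ≤ 2 := by
  have hN0 : 0 < N := by linarith
  have h1 : N * |z - y| ≤ 1 := by
    calc N * |z - y| ≤ N * (1 / N ^ 2) := by gcongr
      _ = 1 / N := by field_simp
      _ ≤ 1 := by rw [div_le_one hN0]; exact hN
  have h2 : N * |y| ≤ |N * z| + 1 := by
    rw [abs_mul, abs_of_pos hN0]
    have : |y| ≤ |z| + |z - y| := by
      have := abs_sub_abs_le_abs_sub y z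
      rw [abs_sub_comm] at this
      linarith
    nlinarith
  have h3 : 0 < 1 + (N * z) ^ 2 := by positivity
  rw [← mul_div_assoc, abs_div, abs_mul, abs_of_pos hN0, abs_of_pos h3, div_le_iff₀ h3]
  have h4 : (N * z) ^ 2 = |N * z| ^ 2 := (sq_abs _).symm
  nlinarith [sq_nonneg (|N * z| - 1)]

theorem tendsto_mul_div_one_add_sq {y : ℝ} {z : ℕ → ℝ}
    (hz : ∀ n : ℕ, |z n - y| ≤ 1 / ((n : ℝ) + 1) ^ 2) :
    Tendsto (fun n : ℕ ↦ y * (((n : ℝ) + 1) / (1 + (((n : ℝ) + 1) * z n) ^ 2))) atTop (𝓝 0) := by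
  rcases eq_or_ne y 0 with rfl | hy
  · simp
  have hN : Tendsto (fun n : ℕ ↦ (n : ℝ) + 1) atTop atTop :=
    tendsto_atTop_add_const_right _ _ tendsto_natCast_atTop_atTop
  have hzy : Tendsto z atTop (𝓝 y) := by
    rw [tendsto_iff_norm_sub_tendsto_zero]
    refine squeeze_zero (fun _ ↦ norm_nonneg _) hz ?_
    simpa [Function.comp_def] using tendsto_inv_atTop_zero.comp
      ((tendsto_pow_atTop (two_ne_zero)).comp hN)
  have hden : Tendsto (fun n : ℕ ↦ 1 / ((n : ℝ) + 1) + ((n : ℝ) + 1) * z n ^ 2) atTop atTop := by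
    have h1 : Tendsto (fun n : ℕ ↦ ((n : ℝ) + 1) * z n ^ 2) atTop atTop :=
      hN.atTop_mul_pos (by positivity : 0 < y ^ 2) (hzy.pow 2)
    refine tendsto_atTop_mono (fun n ↦ ?_) h1
    have : (0 : ℝ) ≤ 1 / ((n : ℝ) + 1) := by positivity
    linarith
  have := (tendsto_inv_atTop_zero.comp hden).const_mul y
  rw [mul_zero] at this
  refine this.congr fun n ↦ ?_
  have h0 : (0 : ℝ) < n + 1 := by positivity
  simp only [Function.comp_apply]
  congr 1
  rw [inv_eq_one_div, div_eq_div_iff (by positivity) (by positivity)]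
  field_simp

section SignLemma

variable {d : ℕ} [NeZero d] {S : Type*} [TopologicalSpace S]
  [ChartedSpace (EuclideanHalfSpace d) S] [IsManifold (𝓡∂ d) ∞ S] [CompactSpace S] [T2Space S]

/-- The linear functional `ψ ↦ ∑ ∫ (ψ a + f b(dψ))` of a test function `ψ` on `S`, given by its
coefficients `a` and `f b` in the charts. -/
def testFunctional (f : S → ℝ) (a : S → EuclideanSpace ℝ (Fin d) → ℝ)
    (b : S → EuclideanSpace ℝ (Fin d) → ((EuclideanSpace ℝ (Fin d) →L[ℝ] ℝ) →L[ℝ] ℝ))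
    (ψ : S → ℝ) : ℝ :=
  ∑ c ∈ partitionIndex d S, ∫ x in chartSupport (d := d) c,
    (ψ ((extChartAt (𝓡∂ d) c).symm x) * a c x +
      f ((extChartAt (𝓡∂ d) c).symm x) * b c x (chartDeriv c ψ x))

theorem continuousOn_comp_symm_chartSupport {F : Type*} [TopologicalSpace F] {f : S → F}
    (hf : Continuous f) (c : S) :
    ContinuousOn (fun x ↦ f ((extChartAt (𝓡∂ d) c).symm x)) (chartSupport (d := d) c) :=
  hf.comp_continuousOn ((continuousOn_extChartAt_symm c).mono (chartSupport_subset c))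

theorem isBoundedOn_comp_symm {F : Type*} [NormedAddCommGroup F] {f : S → F}
    (hf : Continuous f) (c : S) :
    IsBoundedOn (fun x ↦ f ((extChartAt (𝓡∂ d) c).symm x)) (chartSupport (d := d) c) :=
  (continuousOn_comp_symm_chartSupport hf c).isBoundedOn (isCompact_chartSupport c)
    (isCompact_chartSupport c).measurableSet

theorem isBoundedOn_chartDeriv {ψ : S → ℝ} (hψ : ContMDiff (𝓡∂ d) 𝓘(ℝ, ℝ) ∞ ψ) (c : S) :
    IsBoundedOn (chartDeriv (d := d) c ψ) (chartSupport (d := d) c) :=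
  ((contDiffOn_chartDeriv hψ c).continuousOn.mono (chartSupport_subset c)).isBoundedOn
    (isCompact_chartSupport c) (isCompact_chartSupport c).measurableSet

theorem isBoundedOn_testFunctional_integrand {f : S → ℝ} (hf : Continuous f) {c : S}
    {a : EuclideanSpace ℝ (Fin d) → ℝ} (ha : IsBoundedOn a (chartSupport (d := d) c))
    {b : EuclideanSpace ℝ (Fin d) → ((EuclideanSpace ℝ (Fin d) →L[ℝ] ℝ) →L[ℝ] ℝ)}
    (hb : IsBoundedOn b (chartSupport (d := d) c)) {ψ : S → ℝ}
    (hψ : ContMDiff (𝓡∂ d) 𝓘(ℝ, ℝ) ∞ ψ) :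
    IsBoundedOn (fun x ↦ ψ ((extChartAt (𝓡∂ d) c).symm x) * a x +
      f ((extChartAt (𝓡∂ d) c).symm x) * b x (chartDeriv c ψ x)) (chartSupport (d := d) c) :=
  ((isBoundedOn_comp_symm hψ.continuous c).mul ha).add
    ((isBoundedOn_comp_symm hf c).mul (hb.clm_apply (isBoundedOn_chartDeriv hψ c)))

/-- If a functional `ψ ↦ ∑ ∫ (ψ a + f b(dψ))` vanishes identically, then so does the functional
whose coefficients are multiplied by the sign of `f`. Testing with `ψ · arctan (N f)` instead of
`ψ` produces the sign in the limit `N → ∞`; the extra term `ψ · f N / (1 + N² f²) · b(df)` stays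
bounded and tends to zero, thanks to the factor `f`. As test functions have to be smooth, `f` inside
the arctangent is replaced by smooth approximations. -/
theorem testFunctional_sign_eq_zero {f : S → ℝ} (hf : ContMDiff (𝓡∂ d) 𝓘(ℝ, ℝ) 1 f)
    {a : S → EuclideanSpace ℝ (Fin d) → ℝ}
    (ha : ∀ c, IsBoundedOn (a c) (chartSupport (d := d) c))
    {b : S → EuclideanSpace ℝ (Fin d) → ((EuclideanSpace ℝ (Fin d) →L[ℝ] ℝ) →L[ℝ] ℝ)}
    (hb : ∀ c, IsBoundedOn (b c) (chartSupport (d := d) c))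
    (h : ∀ ψ : S → ℝ, ContMDiff (𝓡∂ d) 𝓘(ℝ, ℝ) ∞ ψ → testFunctional f a b ψ = 0)
    {ψ : S → ℝ} (hψ : ContMDiff (𝓡∂ d) 𝓘(ℝ, ℝ) ∞ ψ) :
    testFunctional f (fun c x ↦ Real.sign (f ((extChartAt (𝓡∂ d) c).symm x)) * a c x)
      (fun c x ↦ Real.sign (f ((extChartAt (𝓡∂ d) c).symm x)) • b c x) ψ = 0 := by
  obtain ⟨C, hC⟩ := exists_contMDiff_dist_le_norm_chartDeriv_le hf
  choose u hu huf hud using fun n : ℕ ↦ hC (1 / ((n : ℝ) + 1) ^ 2) (by positivity)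
  have htest : ∀ n : ℕ, ContMDiff (𝓡∂ d) 𝓘(ℝ, ℝ) ∞
      (fun p ↦ ψ p * Real.arctan (((n : ℝ) + 1) * u n p)) := fun n ↦
    hψ.mul (Real.contDiff_arctan.contMDiff.comp (contMDiff_const.mul (hu n)))
  have hderiv : ∀ (n : ℕ) (c : S), ∀ x ∈ chartSupport (d := d) c,
      chartDeriv c (fun p ↦ ψ p * Real.arctan (((n : ℝ) + 1) * u n p)) x =
        Real.arctan (((n : ℝ) + 1) * u n ((extChartAt (𝓡∂ d) c).symm x)) • chartDeriv c ψ x +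
        (ψ ((extChartAt (𝓡∂ d) c).symm x) * (((n : ℝ) + 1) /
          (1 + (((n : ℝ) + 1) * u n ((extChartAt (𝓡∂ d) c).symm x)) ^ 2))) •
          chartDeriv c (u n) x := by
    intro n c x hx
    have hxt := chartSupport_subset c hx
    have h1 := hasFDerivWithinAt_chartDeriv (n := ⊤) le_top hψ c hxt
    have h2 := (hasFDerivWithinAt_chartDeriv (n := ⊤) le_top (hu n) c hxt).const_mul ((n : ℝ) + 1)
    have h3 := chartDeriv_eq_of_hasFDerivWithinAt hxt
      (ψ := fun p ↦ ψ p * Real.arctan (((n : ℝ) + 1) * u n p)) (h1.mul h2.arctan)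
    rw [h3]
    simp only [Function.comp_apply, smul_smul]
    rw [add_comm]
    congr 2
    ring
  have hlim : Tendsto (fun n : ℕ ↦ testFunctional f a b
      (fun p ↦ ψ p * Real.arctan (((n : ℝ) + 1) * u n p))) atTop
      (𝓝 (∑ c ∈ partitionIndex d S, ∫ x in chartSupport (d := d) c, Real.pi / 2 *
        (ψ ((extChartAt (𝓡∂ d) c).symm x) *
            (Real.sign (f ((extChartAt (𝓡∂ d) c).symm x)) * a c x) +
          f ((extChartAt (𝓡∂ d) c).symm x) *
            (Real.sign (f ((extChartAt (𝓡∂ d) c).symm x)) • b c x) (chartDeriv c ψ x)))) := by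
    refine tendsto_finsetSum _ fun c _ ↦ ?_
    have hKm := (isCompact_chartSupport (d := d) c).measurableSet
    obtain ⟨Bψ, hBψ⟩ := (isBoundedOn_comp_symm (d := d) hψ.continuous c).exists_bound
    obtain ⟨Bf, hBf⟩ := (isBoundedOn_comp_symm (d := d) hf.continuous c).exists_bound
    obtain ⟨Ba, hBa⟩ := (ha c).exists_bound
    obtain ⟨Bb, hBb⟩ := (hb c).exists_bound
    obtain ⟨Bd, hBd⟩ := (isBoundedOn_chartDeriv hψ c).exists_bound
    refine tendsto_integral_of_dominated_convergence
      (fun _ ↦ Bψ * (Real.pi / 2) * Ba + (Bf * (Bb * (Real.pi / 2 * Bd)) +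
        2 * Bψ * (Bb * C c)))
      (fun n ↦ (isBoundedOn_testFunctional_integrand hf.continuous (ha c) (hb c)
        (htest n)).aestronglyMeasurable)
      (integrableOn_const (isCompact_chartSupport c).measure_lt_top.ne)
      (fun n ↦ (ae_restrict_iff' hKm).2 (ae_of_all _ fun x hx ↦ ?_))
      ((ae_restrict_iff' hKm).2 (ae_of_all _ fun x hx ↦ ?_))
    · rw [hderiv n c x hx, map_add, map_smul, map_smul]
      set p := (extChartAt (𝓡∂ d) c).symm x
      have hat : |Real.arctan (((n : ℝ) + 1) * u n p)| ≤ Real.pi / 2 :=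
        abs_le.2 ⟨(Real.neg_pi_div_two_lt_arctan _).le, (Real.arctan_lt_pi_div_two _).le⟩
      have hκ := abs_mul_div_one_add_sq_le (y := f p) (z := u n p) (N := (n : ℝ) + 1)
        (by linarith [(Nat.cast_nonneg n : (0 : ℝ) ≤ n)]) (huf n p)
      have hψ0 : 0 ≤ Bψ := (norm_nonneg _).trans (hBψ x hx)
      have hf0 : 0 ≤ Bf := (norm_nonneg _).trans (hBf x hx)
      have hb0 : 0 ≤ Bb := (norm_nonneg (b c x)).trans (hBb x hx)
      have hpi := Real.pi_pos
      have e : f p * (Real.arctan (((n : ℝ) + 1) * u n p) • b c x (chartDeriv c ψ x) +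
          (ψ p * (((n : ℝ) + 1) / (1 + (((n : ℝ) + 1) * u n p) ^ 2))) •
            b c x (chartDeriv c (u n) x)) =
          f p * b c x (Real.arctan (((n : ℝ) + 1) * u n p) • chartDeriv c ψ x) +
          (f p * (((n : ℝ) + 1) / (1 + (((n : ℝ) + 1) * u n p) ^ 2)) * ψ p) *
            b c x (chartDeriv c (u n) x) := by
        simp only [map_smul, smul_eq_mul]; ring
      rw [e]
      refine (norm_add_le _ _).trans (add_le_add ?_ ((norm_add_le _ _).trans (add_le_add ?_ ?_)))
      · rw [norm_mul, norm_mul]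
        exact mul_le_mul (mul_le_mul (hBψ x hx) hat (norm_nonneg _) hψ0) (hBa x hx)
          (norm_nonneg _) (by positivity)
      · rw [norm_mul]
        refine mul_le_mul (hBf x hx) (((b c x).le_opNorm _).trans ?_) (norm_nonneg _) hf0
        refine mul_le_mul (hBb x hx) ?_ (norm_nonneg _) hb0
        rw [norm_smul]
        exact mul_le_mul hat (hBd x hx) (norm_nonneg _) (by positivity)
      · rw [norm_mul, norm_mul]
        refine mul_le_mul (mul_le_mul hκ (hBψ x hx) (norm_nonneg _) zero_le_two) ?_
          (norm_nonneg _) (by positivity)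
        exact ((b c x).le_opNorm _).trans
          (mul_le_mul (hBb x hx) (hud n c x hx) (norm_nonneg _) hb0)
    · set p := (extChartAt (𝓡∂ d) c).symm x
      have h1 := tendsto_arctan_mul_approx (y := f p) (z := fun n ↦ u n p) fun n ↦ huf n p
      have h2 := tendsto_mul_div_one_add_sq (y := f p) (z := fun n ↦ u n p) fun n ↦ huf n p
      have h3 : Tendsto (fun n : ℕ ↦
          (f p * (((n : ℝ) + 1) / (1 + (((n : ℝ) + 1) * u n p) ^ 2))) *
            b c x (chartDeriv c (u n) x)) atTop (𝓝 0) := by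
        refine bdd_le_mul_tendsto_zero' (Bb * C c) (Eventually.of_forall fun n ↦ ?_) h2 |>.congr
          fun n ↦ mul_comm _ _
        exact ((b c x).le_opNorm _).trans (mul_le_mul (hBb x hx) (hud n c x hx) (norm_nonneg _)
          ((norm_nonneg (b c x)).trans (hBb x hx)))
      have h4 := ((h1.const_mul (ψ p)).mul_const (a c x)).add
        (((h1.mul_const (b c x (chartDeriv c ψ x))).const_mul (f p)).add (h3.const_mul (ψ p)))
      refine (h4.congr fun n ↦ ?_).trans_eq ?_
      · rw [hderiv n c x hx, map_add, map_smul, map_smul, smul_eq_mul, smul_eq_mul]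
        ring
      · congr 1
        simp only [_root_.smul_apply, smul_eq_mul]
        ring
  have hzero := tendsto_nhds_unique hlim
    ((tendsto_const_nhds (x := (0 : ℝ))).congr fun n ↦ (h _ (htest n)).symm)
  simp_rw [integral_const_mul, ← Finset.mul_sum] at hzero
  exact (mul_eq_zero.1 hzero).resolve_left (by positivity)

end SignLemma

/-! ### One-sided derivatives of integrals -/

/-- The right derivative of `|u|`. At a zero of `u` it is `|u'|`, and `|u|` is differentiable there
only if `u' = 0`. -/
theorem hasDerivWithinAt_abs_Ioi {u : ℝ → ℝ} {u' x : ℝ} (hu : HasDerivAt u u' x) :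
    HasDerivWithinAt (fun t ↦ |u t|)
      (Real.sign (u x) * u' + if u x = 0 then |u'| else 0) (Ioi x) x := by
  rcases lt_trichotomy (u x) 0 with h | h | h
  · have := (hasDerivAt_abs_neg h).comp x hu
    simpa [Real.sign_of_neg h, h.ne, Function.comp_def] using this.hasDerivWithinAt
  · rw [hasDerivWithinAt_iff_tendsto_slope' (by simp : x ∉ Ioi x)]
    have h1 := (hasDerivWithinAt_iff_tendsto_slope' (by simp : x ∉ Ioi x)).1
      (hu.hasDerivWithinAt (s := Ioi x))
    have h2 := h1.abs
    simp only [h, Real.sign_zero, zero_mul, if_true, zero_add]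
    refine h2.congr' (eventually_nhdsWithin_of_forall fun t ht ↦ ?_)
    have : 0 < t - x := sub_pos.2 ht
    simp [slope_def_field, h, abs_div, abs_of_pos this]
  · have := (hasDerivAt_abs_pos h).comp x hu
    simpa [Real.sign_of_pos h, h.ne', Function.comp_def] using this.hasDerivWithinAt

theorem hasDerivWithinAt_setIntegral_Ioi {E : Type*} [MeasureSpace E] [TopologicalSpace E]
    [IsFiniteMeasureOnCompacts (volume : Measure E)] {K : Set E} (hK : IsCompact K)
    (hKm : MeasurableSet K) {N : ℝ → E → ℝ} {N' : E → ℝ} {C : ℝ}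
    (hN : ∀ᶠ t in 𝓝[>] 0, IsBoundedOn (N t) K) (hN0 : IsBoundedOn (N 0) K)
    (hlip : ∀ᶠ t in 𝓝[>] 0, ∀ x ∈ K, |N t x - N 0 x| ≤ C * |t|)
    (hd : ∀ x ∈ K, HasDerivWithinAt (fun t ↦ N t x) (N' x) (Ioi 0) 0) :
    HasDerivWithinAt (fun t ↦ ∫ x in K, N t x) (∫ x in K, N' x) (Ioi 0) 0 := by
  rw [hasDerivWithinAt_iff_tendsto_slope' (by simp : (0 : ℝ) ∉ Ioi 0)]
  have hint : ∀ᶠ t in 𝓝[>] (0 : ℝ), ∫ x in K, t⁻¹ * (N t x - N 0 x) =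
      slope (fun t ↦ ∫ x in K, N t x) 0 t := by
    filter_upwards [hN] with t ht
    rw [integral_const_mul, integral_sub (ht.integrableOn hK hKm) (hN0.integrableOn hK hKm),
      slope_def_field, sub_zero, div_eq_inv_mul]
  refine Tendsto.congr' hint (tendsto_integral_filter_of_dominated_convergence (fun _ ↦ C) ?_ ?_
    (integrableOn_const hK.measure_lt_top.ne) ?_)
  · filter_upwards [hN] with t ht
    exact (ht.1.sub hN0.1).const_mul _
  · filter_upwards [hlip, self_mem_nhdsWithin] with t ht ht0
    refine (ae_restrict_iff' hKm).2 (ae_of_all _ fun x hx ↦ ?_)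
    have h0 : 0 < |t| := abs_pos.2 (ne_of_gt ht0)
    rw [norm_mul, norm_inv, Real.norm_eq_abs, Real.norm_eq_abs, inv_mul_le_iff₀ h0, mul_comm]
    exact ht x hx
  · refine (ae_restrict_iff' hKm).2 (ae_of_all _ fun x hx ↦ ?_)
    refine ((hasDerivWithinAt_iff_tendsto_slope' (by simp : (0 : ℝ) ∉ Ioi 0)).1
      (hd x hx)).congr fun t ↦ ?_
    rw [slope_def_field, sub_zero, div_eq_inv_mul]

/-- A continuously differentiable function of time and space is Lipschitz in time at time zero,
uniformly on compact sets of space. -/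
theorem exists_eventually_abs_sub_le {E : Type*} [NormedAddCommGroup E] [NormedSpace ℝ E]
    {A K : Set E} (hA : Convex ℝ A) (hKA : K ⊆ A) (hK : IsCompact K) {G : ℝ × E → ℝ}
    (hG : ∀ x ∈ K, ContDiffWithinAt ℝ 1 G (univ ×ˢ A) (0, x)) :
    ∃ C ≥ 0, ∀ᶠ t in 𝓝 (0 : ℝ), ∀ x ∈ K, |G (t, x) - G (0, x)| ≤ C * |t| := by
  refine hK.induction_on (p := fun s ↦ ∃ C ≥ 0, ∀ᶠ t in 𝓝 (0 : ℝ), ∀ x ∈ s,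
    |G (t, x) - G (0, x)| ≤ C * |t|) ⟨0, le_rfl, by simp⟩ ?_ ?_ fun x hx ↦ ?_
  · rintro s t hst ⟨C, hC0, hC⟩
    exact ⟨C, hC0, hC.mono fun τ h x hx ↦ h x (hst hx)⟩
  · rintro s t ⟨C, hC0, hC⟩ ⟨D, -, hD⟩
    refine ⟨max C D, hC0.trans (le_max_left _ _), ?_⟩
    filter_upwards [hC, hD] with τ h1 h2 x hx
    rcases hx with hx | hx
    · exact (h1 x hx).trans (by gcongr; exact le_max_left _ _)
    · exact (h2 x hx).trans (by gcongr; exact le_max_right _ _)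
  · obtain ⟨L, t, ht, hL⟩ := (hG x hx).exists_lipschitzOnWith (convex_univ.prod hA)
    rw [nhdsWithin_prod_eq, nhdsWithin_univ, mem_prod_iff] at ht
    obtain ⟨t₁, ht₁, t₂, ht₂, hsub⟩ := ht
    refine ⟨t₂, nhdsWithin_mono x hKA ht₂, L, L.coe_nonneg, ?_⟩
    filter_upwards [ht₁] with τ hτ y hy
    have h := hL.dist_le_mul (τ, y) (hsub ⟨hτ, hy⟩) (0, y) (hsub ⟨mem_of_mem_nhds ht₁, hy⟩)
    simpa [Prod.dist_eq, Real.dist_eq] using h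

/-! ### The metric pulled back along a deformation -/

section Pullback

variable {d : ℕ} {M : Type*} [TopologicalSpace M]
  [ChartedSpace (EuclideanHalfSpace (d + 1)) M] [IsManifold (𝓡∂ (d + 1)) ∞ M]

/-- The components of the metric pulled back along a smooth map are smooth. -/
theorem LorentzianMetric.contDiffOn_pullback (g : LorentzianMetric d M) {V : Type*}
    [NormedAddCommGroup V] [NormedSpace ℝ V] {Y : V → M} {s : Set V} (hs : UniqueDiffOn ℝ s)
    (hY : ContMDiffOn 𝓘(ℝ, V) (𝓡∂ (d + 1)) ∞ Y s) (w w' : V) :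
    ContDiffOn ℝ ∞ (fun z ↦ g.form (Y z) (mfderivWithin 𝓘(ℝ, V) (𝓡∂ (d + 1)) Y s z w)
      (mfderivWithin 𝓘(ℝ, V) (𝓡∂ (d + 1)) Y s z w')) s := by
  have hvec : ∀ w : V, ContMDiffOn 𝓘(ℝ, V) ((𝓡∂ (d + 1)).prod
      𝓘(ℝ, EuclideanSpace ℝ (Fin (d + 1)))) ∞
      (fun z ↦ (Bundle.TotalSpace.mk' (EuclideanSpace ℝ (Fin (d + 1))) (Y z)
        (mfderivWithin 𝓘(ℝ, V) (𝓡∂ (d + 1)) Y s z w) : TangentBundle (𝓡∂ (d + 1)) M)) s := by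
    intro w
    have h1 := hY.contMDiffOn_tangentMapWithin (m := ∞) (by simp) hs.uniqueMDiffOn
    have h2 : ContMDiffOn 𝓘(ℝ, V) 𝓘(ℝ, V).tangent ∞
        (fun z : V ↦ (⟨z, w⟩ : TangentBundle 𝓘(ℝ, V) V)) s := by
      exact contMDiffOn_vectorSpace_iff_contDiffOn.2 contDiffOn_const
    exact h1.comp h2 fun z hz ↦ hz
  rw [← contMDiffOn_iff_contDiffOn]
  intro z hz
  have : ContMDiffWithinAt 𝓘(ℝ, V) ((𝓡∂ (d + 1)).prod 𝓘(ℝ)) ∞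
      (fun z ↦ Bundle.TotalSpace.mk' ℝ (E := Bundle.Trivial M ℝ) (Y z)
        (g.form (Y z) (mfderivWithin 𝓘(ℝ, V) (𝓡∂ (d + 1)) Y s z w)
          (mfderivWithin 𝓘(ℝ, V) (𝓡∂ (d + 1)) Y s z w'))) s z := by
    apply ContMDiffWithinAt.clm_bundle_apply₂ (F₁ := EuclideanSpace ℝ (Fin (d + 1)))
      (F₂ := EuclideanSpace ℝ (Fin (d + 1)))
    · exact ContMDiffAt.comp_contMDiffWithinAt z g.contMDiff.contMDiffAt (hY z hz)
    · exact hvec w z hz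
    · exact hvec w' z hz
  rw [Bundle.contMDiffWithinAt_totalSpace] at this
  exact this.2

end Pullback

/-! ### The induced metric of reparametrized deformations -/

section Gram

variable {d : ℕ} [NeZero d] {M : Type*} [TopologicalSpace M]
  [ChartedSpace (EuclideanHalfSpace (d + 1)) M]
  {S : Type*} [TopologicalSpace S] [ChartedSpace (EuclideanHalfSpace d) S]

/-- The domain of time and chart coordinates on which a deformation is read in the preferred chart
around `c`. -/
def timeChart (ε : ℝ) (c : S) : Set (ℝ × EuclideanSpace ℝ (Fin d)) :=
  Ioo (-ε) ε ×ˢ (extChartAt (𝓡∂ d) c).target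

/-- A deformation as a map of time and coordinates in the preferred chart around `c`. -/
def readInChart (Φ : ℝ → S → M) (c : S) (z : ℝ × EuclideanSpace ℝ (Fin d)) : M :=
  Φ z.1 ((extChartAt (𝓡∂ d) c).symm z.2)

theorem uniqueDiffOn_timeChart (ε : ℝ) (c : S) : UniqueDiffOn ℝ (timeChart (d := d) ε c) :=
  isOpen_Ioo.uniqueDiffOn.prod (uniqueDiffOn_extChartAt_target c)

theorem timeChart_mem_nhdsWithin {ε : ℝ} (hε : 0 < ε) {c : S} {x : EuclideanSpace ℝ (Fin d)}
    (hx : x ∈ (extChartAt (𝓡∂ d) c).target) :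
    timeChart (d := d) ε c ∈ 𝓝[univ ×ˢ range (𝓡∂ d)] ((0 : ℝ), x) := by
  rw [nhdsWithin_prod_eq, nhdsWithin_univ, ← nhdsWithin_extChartAt_target_eq_of_mem hx]
  exact prod_mem_prod (Ioo_mem_nhds (by linarith) hε) self_mem_nhdsWithin

theorem contMDiffOn_readInChart [IsManifold (𝓡∂ d) ∞ S] {Φ : ℝ → S → M} {ε : ℝ}
    (hΦ : ContMDiffOn (𝓘(ℝ, ℝ).prod (𝓡∂ d)) (𝓡∂ (d + 1)) ∞ (fun z : ℝ × S ↦ Φ z.1 z.2)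
      (Ioo (-ε) ε ×ˢ univ)) (c : S) :
    ContMDiffOn 𝓘(ℝ, ℝ × EuclideanSpace ℝ (Fin d)) (𝓡∂ (d + 1)) ∞ (readInChart (d := d) Φ c)
      (timeChart ε c) := by
  have h1 : ContMDiffOn 𝓘(ℝ, ℝ × EuclideanSpace ℝ (Fin d)) 𝓘(ℝ, ℝ) ∞
      (fun z : ℝ × EuclideanSpace ℝ (Fin d) ↦ z.1) (timeChart ε c) :=
    contDiff_fst.contMDiff.contMDiffOn
  have h2 : ContMDiffOn 𝓘(ℝ, ℝ × EuclideanSpace ℝ (Fin d)) (𝓡∂ d) ∞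
      (fun z : ℝ × EuclideanSpace ℝ (Fin d) ↦ (extChartAt (𝓡∂ d) c).symm z.2) (timeChart ε c) :=
    (contMDiffOn_extChartAt_symm c).comp contDiff_snd.contMDiff.contMDiffOn fun z hz ↦ hz.2
  exact hΦ.comp (h1.prodMk h2) fun z hz ↦ ⟨hz.1, mem_univ _⟩

variable [IsManifold (𝓡∂ (d + 1)) ∞ M]

/-- The determinant of the Gram matrix, for the metric pulled back along a deformation, of the
vectors `q(eᵢ) ∂ₜ + eᵢ` at a point of time and chart coordinates. With `q = t dψ` these are the
coordinate tangent vectors of the surface `p ↦ Φ (t ψ p) p`. -/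
def gramDet (g : LorentzianMetric d M) (Φ : ℝ → S → M) (ε : ℝ) (c : S)
    (y : (ℝ × EuclideanSpace ℝ (Fin d)) × (EuclideanSpace ℝ (Fin d) →L[ℝ] ℝ)) : ℝ :=
  (Matrix.of fun i j : Fin d ↦
    g.form (readInChart Φ c y.1)
      (mfderivWithin 𝓘(ℝ, ℝ × EuclideanSpace ℝ (Fin d)) (𝓡∂ (d + 1)) (readInChart Φ c)
        (timeChart ε c) y.1 (y.2 (EuclideanSpace.single i 1), EuclideanSpace.single i (1 : ℝ)))
      (mfderivWithin 𝓘(ℝ, ℝ × EuclideanSpace ℝ (Fin d)) (𝓡∂ (d + 1)) (readInChart Φ c)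
        (timeChart ε c) y.1
        (y.2 (EuclideanSpace.single j 1), EuclideanSpace.single j (1 : ℝ)))).det

theorem contDiffOn_gramDet [IsManifold (𝓡∂ d) ∞ S] (g : LorentzianMetric d M) {Φ : ℝ → S → M}
    {ε : ℝ} (hΦ : ContMDiffOn (𝓘(ℝ, ℝ).prod (𝓡∂ d)) (𝓡∂ (d + 1)) ∞
      (fun z : ℝ × S ↦ Φ z.1 z.2) (Ioo (-ε) ε ×ˢ univ)) (c : S) :
    ContDiffOn ℝ ∞ (gramDet g Φ ε c) (timeChart (d := d) ε c ×ˢ univ) := by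
  have hsplit : ∀ (r : ℝ) (v : EuclideanSpace ℝ (Fin d)),
      ((r, v) : ℝ × EuclideanSpace ℝ (Fin d)) = r • ((1 : ℝ), 0) + (0, v) := by
    intro r v; simp
  have hpull := fun w w' ↦ (g.contDiffOn_pullback (uniqueDiffOn_timeChart ε c)
    (contMDiffOn_readInChart hΦ c) w w').comp (t := timeChart (d := d) ε c)
    (s := timeChart (d := d) ε c ×ˢ (univ : Set (EuclideanSpace ℝ (Fin d) →L[ℝ] ℝ)))
    contDiff_fst.contDiffOn fun y hy ↦ hy.1
  have hev : ∀ i : Fin d, ContDiffOn ℝ ∞ (fun y : (ℝ × EuclideanSpace ℝ (Fin d)) ×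
      (EuclideanSpace ℝ (Fin d) →L[ℝ] ℝ) ↦ y.2 (EuclideanSpace.single i 1))
      (timeChart (d := d) ε c ×ˢ univ) := fun i ↦
    (contDiff_snd.clm_apply contDiff_const).contDiffOn
  unfold gramDet
  simp only [Matrix.det_apply, Matrix.of_apply]
  refine ContDiffOn.sum fun σ _ ↦ ContDiffOn.const_smul _ (contDiffOn_prod fun i _ ↦ ?_)
  have hexp := (((hev (σ i)).mul (hev i)).mul (hpull ((1 : ℝ), 0) ((1 : ℝ), 0))).add
    (((hev (σ i)).mul (hpull ((1 : ℝ), 0) (0, EuclideanSpace.single i 1))).add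
    (((hev i).mul (hpull (0, EuclideanSpace.single (σ i) 1) ((1 : ℝ), 0))).add
      (hpull (0, EuclideanSpace.single (σ i) 1) (0, EuclideanSpace.single i 1))))
  refine hexp.congr fun y _ ↦ ?_
  have hlin : ∀ i : Fin d,
      mfderivWithin 𝓘(ℝ, ℝ × EuclideanSpace ℝ (Fin d)) (𝓡∂ (d + 1)) (readInChart Φ c)
        (timeChart ε c) y.1 (y.2 (EuclideanSpace.single i 1), EuclideanSpace.single i (1 : ℝ)) =
      y.2 (EuclideanSpace.single i 1) •
        mfderivWithin 𝓘(ℝ, ℝ × EuclideanSpace ℝ (Fin d)) (𝓡∂ (d + 1)) (readInChart Φ c)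
          (timeChart ε c) y.1 ((1 : ℝ), (0 : EuclideanSpace ℝ (Fin d))) +
      mfderivWithin 𝓘(ℝ, ℝ × EuclideanSpace ℝ (Fin d)) (𝓡∂ (d + 1)) (readInChart Φ c)
        (timeChart ε c) y.1 ((0 : ℝ), EuclideanSpace.single i (1 : ℝ)) := by
    intro i
    rw [hsplit]
    exact (map_add _ _ _).trans (congrArg (· + _) (map_smul _ _ _))
  rw [hlin, hlin]
  simp only [map_add, map_smul, add_apply, _root_.smul_apply, smul_eq_mul, Function.comp_apply]
  ring

/-- The chain rule: the surface `p ↦ Φ (t ψ p) p` factors in a chart through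
`x ↦ (t ψ(x), x)`. -/
theorem det_inducedMetric_eq_gramDet [IsManifold (𝓡∂ d) ∞ S] (g : LorentzianMetric d M)
    {Φ : ℝ → S → M} {ε : ℝ} (hΦ : ContMDiffOn (𝓘(ℝ, ℝ).prod (𝓡∂ d)) (𝓡∂ (d + 1)) ∞
      (fun z : ℝ × S ↦ Φ z.1 z.2) (Ioo (-ε) ε ×ˢ univ)) {ψ : S → ℝ}
    (hψ : ContMDiff (𝓡∂ d) 𝓘(ℝ, ℝ) ∞ ψ) {t : ℝ} (ht : ∀ p, t * ψ p ∈ Ioo (-ε) ε) {c : S}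
    {x : EuclideanSpace ℝ (Fin d)} (hx : x ∈ (extChartAt (𝓡∂ d) c).target) :
    (inducedMetric g (fun p ↦ Φ (t * ψ p) p) c x).det =
      gramDet g Φ ε c ((t * ψ ((extChartAt (𝓡∂ d) c).symm x), x), t • chartDeriv c ψ x) := by
  let ι : EuclideanSpace ℝ (Fin d) → ℝ × EuclideanSpace ℝ (Fin d) :=
    fun x ↦ (t * ψ ((extChartAt (𝓡∂ d) c).symm x), x)
  have hι : HasFDerivWithinAt ι ((t • chartDeriv c ψ x).prod (ContinuousLinearMap.id ℝ _))
      (extChartAt (𝓡∂ d) c).target x :=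
    ((hasFDerivWithinAt_chartDeriv (n := ⊤) le_top hψ c hx).const_mul t).prodMk
      (hasFDerivWithinAt_id x _)
  have hmaps : ∀ x ∈ (extChartAt (𝓡∂ d) c).target, ι x ∈ timeChart ε c := fun x hx ↦ ⟨ht _, hx⟩
  have hcomp : mfderivWithin 𝓘(ℝ, EuclideanSpace ℝ (Fin d)) (𝓡∂ (d + 1))
      (readInChart Φ c ∘ ι) (extChartAt (𝓡∂ d) c).target x =
      (mfderivWithin 𝓘(ℝ, ℝ × EuclideanSpace ℝ (Fin d)) (𝓡∂ (d + 1)) (readInChart Φ c)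
        (timeChart ε c) (ι x)).comp
      (mfderivWithin 𝓘(ℝ, EuclideanSpace ℝ (Fin d)) 𝓘(ℝ, ℝ × EuclideanSpace ℝ (Fin d)) ι
        (extChartAt (𝓡∂ d) c).target x) :=
    mfderivWithin_comp x
      ((contMDiffOn_readInChart hΦ c).mdifferentiableOn (by simp) _ (hmaps x hx))
      hι.differentiableWithinAt.mdifferentiableWithinAt hmaps
      (uniqueDiffOn_extChartAt_target c x hx).uniqueMDiffWithinAt
  rw [mfderivWithin_eq_fderivWithin,
    hι.fderivWithin (uniqueDiffOn_extChartAt_target c x hx)] at hcomp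
  have hvec : ∀ i, coordTangent (fun p ↦ Φ (t * ψ p) p) c x i =
      mfderivWithin 𝓘(ℝ, ℝ × EuclideanSpace ℝ (Fin d)) (𝓡∂ (d + 1)) (readInChart Φ c)
        (timeChart ε c) (ι x) ((t • chartDeriv c ψ x) (EuclideanSpace.single i 1),
          EuclideanSpace.single i (1 : ℝ)) := fun i ↦
    congrArg (fun A : EuclideanSpace ℝ (Fin d) →L[ℝ] EuclideanSpace ℝ (Fin (d + 1)) ↦
      A (EuclideanSpace.single i (1 : ℝ))) hcomp
  unfold inducedMetric gramDet
  simp only [hvec]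
  rfl

/-- The induced metric of a spacelike surface has a positive determinant. -/
theorem det_inducedMetric_pos [IsManifold (𝓡∂ d) ∞ S] (g : LorentzianMetric d M) {X : S → M}
    (hX : ContMDiff (𝓡∂ d) (𝓡∂ (d + 1)) ∞ X)
    (hsp : ∀ (p : S) (v : TangentSpace (𝓡∂ d) p), v ≠ 0 →
      0 < g.form (X p) (mfderiv (𝓡∂ d) (𝓡∂ (d + 1)) X p v)
        (mfderiv (𝓡∂ d) (𝓡∂ (d + 1)) X p v)) {c : S}
    {x : EuclideanSpace ℝ (Fin d)} (hx : x ∈ (extChartAt (𝓡∂ d) c).target) :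
    0 < (inducedMetric g X c x).det := by
  set p := (extChartAt (𝓡∂ d) c).symm x
  have hsymm := (contMDiffOn_extChartAt_symm (I := 𝓡∂ d) (n := ∞) c).mdifferentiableOn
    (by simp) x hx
  let A : EuclideanSpace ℝ (Fin d) →L[ℝ] TangentSpace (𝓡∂ d) p :=
    mfderivWithin 𝓘(ℝ, EuclideanSpace ℝ (Fin d)) (𝓡∂ d) (extChartAt (𝓡∂ d) c).symm
      (extChartAt (𝓡∂ d) c).target x
  have hA : Function.Injective A := by
    have hset : A = mfderivWithin 𝓘(ℝ, EuclideanSpace ℝ (Fin d)) (𝓡∂ d)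
        (extChartAt (𝓡∂ d) c).symm (range (𝓡∂ d)) x :=
      mfderivWithin_congr_set' (y := x) 
        ((extChartAt_target_eventuallyEq_of_mem hx).filter_mono nhdsWithin_le_nhds)
    rw [hset]
    exact (isInvertible_mfderivWithin_extChartAt_symm hx).injective
  let B : EuclideanSpace ℝ (Fin d) →L[ℝ] TangentSpace (𝓡∂ (d + 1)) (X p) :=
    (mfderiv (𝓡∂ d) (𝓡∂ (d + 1)) X p).comp A
  have hB : ∀ i, coordTangent X c x i = B (EuclideanSpace.single i (1 : ℝ)) := by
    intro i
    have h := mfderiv_comp_mfderivWithin (I := 𝓘(ℝ, EuclideanSpace ℝ (Fin d))) (I' := 𝓡∂ d)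
      (I'' := 𝓡∂ (d + 1)) (f := (extChartAt (𝓡∂ d) c).symm) (g := X) x
      (hX.mdifferentiableAt (by simp)) hsymm
      (uniqueDiffOn_extChartAt_target c x hx).uniqueMDiffWithinAt
    exact congrArg (fun A : EuclideanSpace ℝ (Fin d) →L[ℝ] EuclideanSpace ℝ (Fin (d + 1)) ↦
      A (EuclideanSpace.single i (1 : ℝ))) h
  refine Matrix.PosDef.det_pos (Matrix.PosDef.of_dotProduct_mulVec_pos ?_ fun w hw ↦ ?_)
  · ext i j
    simp only [Matrix.conjTranspose_apply, inducedMetric, Matrix.of_apply, star_trivial]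
    exact g.symm _ _ _
  · have hw' : WithLp.toLp 2 w ≠ (0 : EuclideanSpace ℝ (Fin d)) := by
      simpa using hw
    have hpos := hsp p (A (WithLp.toLp 2 w)) fun h ↦ hw' (hA (h.trans (map_zero A).symm))
    have hsum : B (WithLp.toLp 2 w) = ∑ i, w i • B (EuclideanSpace.single i (1 : ℝ)) := by
      have : (WithLp.toLp 2 w : EuclideanSpace ℝ (Fin d)) =
          ∑ i, w i • EuclideanSpace.single i (1 : ℝ) := by
        ext j
        simp [Finset.sum_apply, Pi.single_apply]
      rw [this, map_sum]
      simp only [map_smul]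
    have hval : star w ⬝ᵥ (inducedMetric g X c x).mulVec w =
        g.form (X p) (B (WithLp.toLp 2 w)) (B (WithLp.toLp 2 w)) := by
      rw [hsum]
      simp only [map_sum, map_smul, _root_.sum_apply, _root_.smul_apply,
        dotProduct, Matrix.mulVec, inducedMetric, Matrix.of_apply, hB, star_trivial, smul_eq_mul,
        Finset.mul_sum, Pi.star_apply]
      rw [Finset.sum_comm]
      refine Finset.sum_congr rfl fun i _ ↦ Finset.sum_congr rfl fun j _ ↦ ?_
      ring
    rw [hval]
    exact hpos

end Gram

/-! ### The first variation along reparametrized deformations -/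

section Variation

variable {d : ℕ} [NeZero d] {M : Type*} [TopologicalSpace M]
  [ChartedSpace (EuclideanHalfSpace (d + 1)) M]
  {S : Type*} [TopologicalSpace S] [ChartedSpace (EuclideanHalfSpace d) S]

theorem exists_forall_mul_mem_Ioo [CompactSpace S] {ψ : S → ℝ} (hψ : Continuous ψ) {ε : ℝ}
    (hε : 0 < ε) : ∃ δ > 0, ∀ t ∈ Ioo (-δ) δ, ∀ p, t * ψ p ∈ Ioo (-ε) ε := by
  obtain ⟨C, hC⟩ := isCompact_univ.exists_bound_of_continuousOn hψ.continuousOn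
  refine ⟨ε / (|C| + 1), by positivity, fun t ht p ↦ abs_lt.1 ?_⟩
  have h1 : |ψ p| ≤ |C| := (hC p (mem_univ p)).trans (le_abs_self C)
  have h2 : |t| < ε / (|C| + 1) := abs_lt.2 ht
  rw [abs_mul]
  calc |t| * |ψ p| ≤ |t| * (|C| + 1) := by gcongr; linarith
    _ < ε / (|C| + 1) * (|C| + 1) := by gcongr
    _ = ε := by field_simp

/-- Reparametrizing the time of a deformation by a function of the point of the surface multiplies
the velocity of the deformation by that function. -/
theorem IsVariation.reparametrize [IsManifold (𝓡∂ d) ∞ S] [CompactSpace S] {X : S → M}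
    {Φ : ℝ → S → M} (hΦ : IsVariation d X Φ) {ψ : S → ℝ} (hψ : ContMDiff (𝓡∂ d) 𝓘(ℝ, ℝ) ∞ ψ) :
    IsVariation d X (fun t p ↦ Φ (t * ψ p) p) := by
  obtain ⟨h0, ε, hε, hs, hb⟩ := hΦ
  obtain ⟨δ, hδ, hδε⟩ := exists_forall_mul_mem_Ioo hψ.continuous hε
  refine ⟨by simp [h0], δ, hδ, ?_, fun t ht p hp ↦ hb _ (hδε t ht p) p hp⟩
  have h1 : ContMDiff (𝓘(ℝ, ℝ).prod (𝓡∂ d)) (𝓘(ℝ, ℝ).prod (𝓡∂ d)) ∞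
      (fun z : ℝ × S ↦ (z.1 * ψ z.2, z.2)) :=
    (contMDiff_fst.mul (hψ.comp contMDiff_snd)).prodMk contMDiff_snd
  exact hs.comp h1.contMDiffOn fun z hz ↦ ⟨hδε z.1 hz.1 z.2, mem_univ _⟩

theorem hasDerivAt_comp_readInChart [IsManifold (𝓡∂ d) ∞ S] [IsManifold (𝓡∂ (d + 1)) ∞ M]
    {F : M → ℝ} (hF : ContMDiff (𝓡∂ (d + 1)) 𝓘(ℝ, ℝ) 1 F) {Φ : ℝ → S → M} {ε : ℝ} (hε : 0 < ε)
    (hΦ : ContMDiffOn (𝓘(ℝ, ℝ).prod (𝓡∂ d)) (𝓡∂ (d + 1)) ∞ (fun z : ℝ × S ↦ Φ z.1 z.2)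
      (Ioo (-ε) ε ×ˢ univ)) {c : S} {x : EuclideanSpace ℝ (Fin d)}
    (hx : x ∈ (extChartAt (𝓡∂ d) c).target) :
    HasDerivAt (fun t ↦ F (Φ t ((extChartAt (𝓡∂ d) c).symm x)))
      (fderivWithin ℝ (F ∘ readInChart Φ c) (timeChart ε c) (0, x) (1, 0)) 0 := by
  have h1 : ContDiffOn ℝ 1 (F ∘ readInChart (d := d) Φ c) (timeChart ε c) :=
    contMDiffOn_iff_contDiffOn.1
      (hF.comp_contMDiffOn ((contMDiffOn_readInChart hΦ c).of_le (by exact_mod_cast le_top)))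
  have h0 : (0 : ℝ) ∈ Ioo (-ε) ε := ⟨by linarith, hε⟩
  have h2 := (h1.differentiableOn one_ne_zero (0, x) ⟨h0, hx⟩).hasFDerivWithinAt
  have h3 : HasDerivWithinAt (fun t : ℝ ↦ (t, x)) ((1 : ℝ), (0 : EuclideanSpace ℝ (Fin d)))
      (Ioo (-ε) ε) 0 := (hasDerivWithinAt_id 0 _).prodMk (hasDerivWithinAt_const 0 _ x)
  have h4 : MapsTo (fun t : ℝ ↦ (t, x)) (Ioo (-ε) ε) (timeChart ε c) := fun t ht ↦ ⟨ht, hx⟩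
  exact (HasFDerivWithinAt.comp_hasDerivWithinAt (0 : ℝ) h2 h3 h4).hasDerivAt
    (Ioo_mem_nhds h0.1 h0.2)

/-- The time derivative at time zero of `F` along a deformation. -/
def velocity (F : M → ℝ) (Φ : ℝ → S → M) (p : S) : ℝ :=
  deriv (fun t ↦ F (Φ t p)) 0

theorem hasDerivAt_velocity [IsManifold (𝓡∂ d) ∞ S] [IsManifold (𝓡∂ (d + 1)) ∞ M]
    {F : M → ℝ} (hF : ContMDiff (𝓡∂ (d + 1)) 𝓘(ℝ, ℝ) 1 F) {Φ : ℝ → S → M} {ε : ℝ} (hε : 0 < ε)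
    (hΦ : ContMDiffOn (𝓘(ℝ, ℝ).prod (𝓡∂ d)) (𝓡∂ (d + 1)) ∞ (fun z : ℝ × S ↦ Φ z.1 z.2)
      (Ioo (-ε) ε ×ˢ univ)) (p : S) :
    HasDerivAt (fun t ↦ F (Φ t p)) (velocity F Φ p) 0 := by
  have h := hasDerivAt_comp_readInChart hF hε hΦ (mem_extChartAt_target (I := 𝓡∂ d) p)
  rw [(extChartAt (𝓡∂ d) p).left_inv (mem_extChartAt_source p)] at h
  exact h.differentiableAt.hasDerivAt

theorem continuous_velocity [IsManifold (𝓡∂ d) ∞ S] [IsManifold (𝓡∂ (d + 1)) ∞ M]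
    {F : M → ℝ} (hF : ContMDiff (𝓡∂ (d + 1)) 𝓘(ℝ, ℝ) 1 F) {Φ : ℝ → S → M} {ε : ℝ} (hε : 0 < ε)
    (hΦ : ContMDiffOn (𝓘(ℝ, ℝ).prod (𝓡∂ d)) (𝓡∂ (d + 1)) ∞ (fun z : ℝ × S ↦ Φ z.1 z.2)
      (Ioo (-ε) ε ×ˢ univ)) :
    Continuous (velocity F Φ) := by
  rw [continuous_iff_continuousAt]
  intro c
  have h1 : ContDiffOn ℝ 1 (F ∘ readInChart (d := d) Φ c) (timeChart ε c) :=
    contMDiffOn_iff_contDiffOn.1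
      (hF.comp_contMDiffOn ((contMDiffOn_readInChart hΦ c).of_le (by exact_mod_cast le_top)))
  have h2 : ContinuousOn (fun x ↦ fderivWithin ℝ (F ∘ readInChart (d := d) Φ c) (timeChart ε c)
      ((0 : ℝ), x) (1, 0)) (extChartAt (𝓡∂ d) c).target :=
    ((h1.continuousOn_fderivWithin (uniqueDiffOn_timeChart ε c) le_rfl).comp
      (f := fun x : EuclideanSpace ℝ (Fin d) ↦ ((0 : ℝ), x))
      (by fun_prop) fun x hx ↦ ⟨⟨by linarith, hε⟩, hx⟩).clm_apply continuousOn_const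
  have h3 := h2.comp (continuousOn_extChartAt (I := 𝓡∂ d) c) (extChartAt (𝓡∂ d) c).mapsTo
  refine ((h3.congr fun p hp ↦ ?_).continuousAt (extChartAt_source_mem_nhds (I := 𝓡∂ d) c))
  have h := hasDerivAt_comp_readInChart hF hε hΦ ((extChartAt (𝓡∂ d) c).map_source hp)
  rw [(extChartAt (𝓡∂ d) c).left_inv hp] at h
  exact h.deriv

variable [IsManifold (𝓡∂ (d + 1)) ∞ M]

/-- The area density `√h` of the undeformed surface in the preferred chart around `c`. -/
def areaDensity (g : LorentzianMetric d M) (Φ : ℝ → S → M) (ε : ℝ) (c : S)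
    (x : EuclideanSpace ℝ (Fin d)) : ℝ :=
  Real.sqrt (gramDet g Φ ε c ((0, x), 0))

/-- The derivative at the undeformed surface of the area density `√h`, as a linear form in the
displacements of time, of the point, and of the tilt `q` of `gramDet`. -/
def areaDensityDeriv (g : LorentzianMetric d M) (Φ : ℝ → S → M) (ε : ℝ) (c : S)
    (x : EuclideanSpace ℝ (Fin d)) :
    (ℝ × EuclideanSpace ℝ (Fin d)) × (EuclideanSpace ℝ (Fin d) →L[ℝ] ℝ) →L[ℝ] ℝ :=
  (1 / (2 * areaDensity g Φ ε c x)) •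
    fderivWithin ℝ (gramDet g Φ ε c) (timeChart ε c ×ˢ univ) ((0, x), 0)

theorem areaDensityDeriv_apply (g : LorentzianMetric d M) (Φ : ℝ → S → M) (ε : ℝ) (c : S)
    (x : EuclideanSpace ℝ (Fin d)) (r : ℝ) (q : EuclideanSpace ℝ (Fin d) →L[ℝ] ℝ) :
    areaDensityDeriv g Φ ε c x ((r, 0), q) =
      r * areaDensityDeriv g Φ ε c x ((1, 0), 0) + areaDensityDeriv g Φ ε c x (0, q) := by
  rw [← smul_eq_mul, ← map_smul, ← map_add]
  simp

/-- A spacelike surface `Φ 0`, with a smooth deformation `Φ` defined for times in `(-ε, ε)`. -/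
structure IsSpacelikeDeformation (g : LorentzianMetric d M) (Φ : ℝ → S → M) (ε : ℝ) : Prop where
  pos : 0 < ε
  smooth : ContMDiffOn (𝓘(ℝ, ℝ).prod (𝓡∂ d)) (𝓡∂ (d + 1)) ∞ (fun z : ℝ × S ↦ Φ z.1 z.2)
    (Ioo (-ε) ε ×ˢ univ)
  det_pos : ∀ c : S, ∀ x ∈ (extChartAt (𝓡∂ d) c).target, 0 < (inducedMetric g (Φ 0) c x).det

namespace IsSpacelikeDeformation

variable {g : LorentzianMetric d M} {Φ : ℝ → S → M} {ε : ℝ}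

theorem zero_mem (h : IsSpacelikeDeformation g Φ ε) : (0 : ℝ) ∈ Ioo (-ε) ε :=
  ⟨by linarith [h.pos], h.pos⟩

theorem contMDiff_zero (h : IsSpacelikeDeformation g Φ ε) :
    ContMDiff (𝓡∂ d) (𝓡∂ (d + 1)) ∞ (Φ 0) := by
  have h1 : ContMDiff (𝓡∂ d) (𝓘(ℝ, ℝ).prod (𝓡∂ d)) ∞ (fun p : S ↦ ((0 : ℝ), p)) :=
    contMDiff_const.prodMk contMDiff_id
  rw [← contMDiffOn_univ]
  exact h.smooth.comp h1.contMDiffOn fun p _ ↦ ⟨h.zero_mem, mem_univ _⟩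

theorem contMDiff_comp_zero (h : IsSpacelikeDeformation g Φ ε) {F : M → ℝ}
    (hF : ContMDiff (𝓡∂ (d + 1)) 𝓘(ℝ, ℝ) 1 F) :
    ContMDiff (𝓡∂ d) 𝓘(ℝ, ℝ) 1 (fun p ↦ F (Φ 0 p)) :=
  hF.comp (h.contMDiff_zero.of_le (by exact_mod_cast le_top))

variable [IsManifold (𝓡∂ d) ∞ S]

theorem hasDerivAt_comp_reparametrize (h : IsSpacelikeDeformation g Φ ε) {F : M → ℝ}
    (hF : ContMDiff (𝓡∂ (d + 1)) 𝓘(ℝ, ℝ) 1 F) (ψ : S → ℝ) (p : S) :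
    HasDerivAt (fun t ↦ F (Φ (t * ψ p) p)) (ψ p * velocity F Φ p) 0 := by
  have h1 := hasDerivAt_velocity hF h.pos h.smooth p
  have h2 : HasDerivAt (fun t : ℝ ↦ t * ψ p) (ψ p) 0 := by
    simpa using (hasDerivAt_id (0 : ℝ)).mul_const (ψ p)
  rw [← zero_mul (ψ p)] at h1
  simpa [Function.comp_def, mul_comm] using h1.comp (0 : ℝ) h2

theorem gramDet_pos (h : IsSpacelikeDeformation g Φ ε) {c : S} {x : EuclideanSpace ℝ (Fin d)}
    (hx : x ∈ (extChartAt (𝓡∂ d) c).target) : 0 < gramDet g Φ ε c ((0, x), 0) := by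
  have h1 := det_inducedMetric_eq_gramDet g h.smooth (ψ := fun _ ↦ (0 : ℝ)) contMDiff_const (t := 0)
    (fun _ ↦ by simpa using h.pos) hx
  simp only [mul_zero, zero_smul] at h1
  rw [← h1]
  exact h.det_pos c x hx

theorem hasFDerivWithinAt_sqrt_gramDet (h : IsSpacelikeDeformation g Φ ε) {c : S}
    {x : EuclideanSpace ℝ (Fin d)} (hx : x ∈ (extChartAt (𝓡∂ d) c).target) :
    HasFDerivWithinAt (fun y ↦ Real.sqrt (gramDet g Φ ε c y)) (areaDensityDeriv g Φ ε c x)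
      (timeChart ε c ×ˢ univ) ((0, x), 0) :=
  ((contDiffOn_gramDet g h.smooth c).differentiableOn (by simp) ((0, x), 0)
    ⟨⟨h.zero_mem, hx⟩, mem_univ _⟩).hasFDerivWithinAt.sqrt (h.gramDet_pos hx).ne'

theorem continuousOn_areaDensity (h : IsSpacelikeDeformation g Φ ε) (c : S) :
    ContinuousOn (areaDensity g Φ ε c) (extChartAt (𝓡∂ d) c).target :=
  ((contDiffOn_gramDet g h.smooth c).continuousOn.comp
    (f := fun x : EuclideanSpace ℝ (Fin d) ↦ (((0 : ℝ), x), (0 : EuclideanSpace ℝ (Fin d) →L[ℝ] ℝ)))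
    (by fun_prop) fun x hx ↦ ⟨⟨h.zero_mem, hx⟩, mem_univ _⟩).sqrt

theorem areaDensity_pos (h : IsSpacelikeDeformation g Φ ε) {c : S} {x : EuclideanSpace ℝ (Fin d)}
    (hx : x ∈ (extChartAt (𝓡∂ d) c).target) : 0 < areaDensity g Φ ε c x :=
  Real.sqrt_pos.2 (h.gramDet_pos hx)

theorem continuousOn_areaDensityDeriv (h : IsSpacelikeDeformation g Φ ε) (c : S) :
    ContinuousOn (areaDensityDeriv g Φ ε c) (extChartAt (𝓡∂ d) c).target := by
  have h1 : ContinuousOn (fun x ↦ 1 / (2 * areaDensity g Φ ε c x)) (extChartAt (𝓡∂ d) c).target :=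
    continuousOn_const.div (continuousOn_const.mul (h.continuousOn_areaDensity c))
      fun x hx ↦ (mul_pos two_pos (h.areaDensity_pos hx)).ne'
  have h2 := ((contDiffOn_gramDet g h.smooth c).continuousOn_fderivWithin
      ((uniqueDiffOn_timeChart ε c).prod uniqueDiffOn_univ) (by simp)).comp
      (s := (extChartAt (𝓡∂ d) c).target) (f := fun x : EuclideanSpace ℝ (Fin d) ↦
        (((0 : ℝ), x), (0 : EuclideanSpace ℝ (Fin d) →L[ℝ] ℝ)))
      (by fun_prop) fun x hx ↦ ⟨⟨h.zero_mem, hx⟩, mem_univ _⟩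
  exact h1.smul h2

end IsSpacelikeDeformation

variable [IsManifold (𝓡∂ d) ∞ S]

theorem IsVariation.exists_isSpacelikeDeformation {g : LorentzianMetric d M}
    {T : TimeOrientation g} {σ : Set M} {X : S → M} (hX : IsAnchoredCauchySurface g T σ X)
    {Φ : ℝ → S → M} (hΦ : IsVariation d X Φ) : ∃ ε, IsSpacelikeDeformation g Φ ε := by
  obtain ⟨h0, ε, hε, hs, -⟩ := hΦ
  exact ⟨ε, hε, hs, fun c x hx ↦ h0 ▸ det_inducedMetric_pos g hX.smooth hX.spacelike hx⟩

variable [CompactSpace S] [T2Space S]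

theorem surfaceFunctional_eq_sum (g : LorentzianMetric d M) (F : M → ℝ) (X : S → M) :
    surfaceFunctional g F X = ∑ c ∈ partitionIndex d S, ∫ x in chartSupport (d := d) c,
      chartPartition (d := d) S c ((extChartAt (𝓡∂ d) c).symm x) *
      (Real.sqrt (inducedMetric g X c x).det * F (X ((extChartAt (𝓡∂ d) c).symm x))) := by
  unfold surfaceFunctional
  rw [finsum_eq_sum_of_support_subset (s := partitionIndex d S) _ fun c hc ↦ ?_]
  · refine Finset.sum_congr rfl fun c _ ↦ ?_
    refine setIntegral_eq_of_subset_of_forall_sdiff_eq_zero (measurableSet_extChartAt_target c)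
      (chartSupport_subset c) fun x hx ↦ ?_
    rw [chartPartition_symm_eq_zero hx.1 hx.2, zero_mul]
  · by_contra hc'
    refine hc ?_
    simp [chartPartition_eq_zero hc']

/-- The right derivative of `∫ √h F` along the reparametrization by `ψ` of a deformation, for a
function `F` that is only assumed to have right derivatives along the deformation and to be
controlled by a continuously differentiable function; this covers the absolute value of the
latter. -/
theorem IsSpacelikeDeformation.hasDerivWithinAt_surfaceFunctional {g : LorentzianMetric d M}
    {Φ : ℝ → S → M} {ε : ℝ} (h : IsSpacelikeDeformation g Φ ε) {F₀ F : M → ℝ}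
    (hF₀ : ContMDiff (𝓡∂ (d + 1)) 𝓘(ℝ, ℝ) 1 F₀) (hF : Continuous F)
    (hFF₀ : ∀ y y', |F y - F y'| ≤ |F₀ y - F₀ y'|) {ψ : S → ℝ}
    (hψ : ContMDiff (𝓡∂ d) 𝓘(ℝ, ℝ) ∞ ψ) {w : S → ℝ}
    (hw : ∀ p, HasDerivWithinAt (fun t ↦ F (Φ (t * ψ p) p)) (w p) (Ioi 0) 0) :
    HasDerivWithinAt (fun t ↦ surfaceFunctional g F (fun p ↦ Φ (t * ψ p) p))
      (∑ c ∈ partitionIndex d S, ∫ x in chartSupport (d := d) c,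
        chartPartition (d := d) S c ((extChartAt (𝓡∂ d) c).symm x) *
        (areaDensityDeriv g Φ ε c x
            ((ψ ((extChartAt (𝓡∂ d) c).symm x), 0), chartDeriv c ψ x) *
            F (Φ 0 ((extChartAt (𝓡∂ d) c).symm x)) +
          areaDensity g Φ ε c x * w ((extChartAt (𝓡∂ d) c).symm x))) (Ioi 0) 0 := by
  obtain ⟨δ, hδ, hδε⟩ := exists_forall_mul_mem_Ioo hψ.continuous h.pos
  have h0δ : (0 : ℝ) ∈ Ioo (-δ) δ := ⟨by linarith, hδ⟩
  have hnhds : Ioo (-δ) δ ∈ 𝓝 (0 : ℝ) := Ioo_mem_nhds h0δ.1 h0δ.2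
  let γ : S → ℝ × EuclideanSpace ℝ (Fin d) →
      (ℝ × EuclideanSpace ℝ (Fin d)) × (EuclideanSpace ℝ (Fin d) →L[ℝ] ℝ) := fun c z ↦
    ((z.1 * ψ ((extChartAt (𝓡∂ d) c).symm z.2), z.2), z.1 • chartDeriv c ψ z.2)
  let N : S → ℝ → EuclideanSpace ℝ (Fin d) → ℝ := fun c t x ↦
    chartPartition (d := d) S c ((extChartAt (𝓡∂ d) c).symm x) *
      (Real.sqrt (gramDet g Φ ε c (γ c (t, x))) *
        F (Φ (t * ψ ((extChartAt (𝓡∂ d) c).symm x)) ((extChartAt (𝓡∂ d) c).symm x)))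
  have hWN : ∀ t ∈ Ioo (-δ) δ, surfaceFunctional g F (fun p ↦ Φ (t * ψ p) p) =
      ∑ c ∈ partitionIndex d S, ∫ x in chartSupport (d := d) c, N c t x := by
    intro t ht
    rw [surfaceFunctional_eq_sum]
    refine Finset.sum_congr rfl fun c _ ↦
      setIntegral_congr_fun (isCompact_chartSupport c).measurableSet fun x hx ↦ ?_
    simp only [N, γ]
    rw [det_inducedMetric_eq_gramDet g h.smooth hψ (hδε t ht) (chartSupport_subset c hx)]
  have hγ : ∀ c, ContDiffOn ℝ ∞ (γ c) (timeChart δ c) := fun c ↦ by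
    have h1 := (contDiffOn_comp_extChartAt_symm (n := ⊤) hψ c).comp
      (s := timeChart δ c) contDiff_snd.contDiffOn fun z hz ↦ hz.2
    have h2 := (contDiffOn_chartDeriv hψ c).comp
      (s := timeChart δ c) contDiff_snd.contDiffOn fun z hz ↦ hz.2
    exact ((contDiff_fst.contDiffOn.mul h1).prodMk contDiff_snd.contDiffOn).prodMk
      (contDiff_fst.contDiffOn.smul h2)
  have hγmaps : ∀ c, MapsTo (γ c) (timeChart δ c) (timeChart ε c ×ˢ univ) := fun c z hz ↦
    ⟨⟨hδε z.1 hz.1 _, hz.2⟩, mem_univ _⟩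
  have hγ0 : ∀ c x, γ c (0, x) = ((0, x), 0) := fun c x ↦ by simp [γ]
  have hcont : ∀ t ∈ Ioo (-δ) δ, Continuous (fun p ↦ Φ (t * ψ p) p) := fun t ht ↦
    h.smooth.continuousOn.comp_continuous (f := fun p ↦ (t * ψ p, p))
      ((continuous_const.mul hψ.continuous).prodMk continuous_id)
      fun p ↦ ⟨hδε t ht p, mem_univ _⟩
  have hbdd : ∀ c, ∀ t ∈ Ioo (-δ) δ, IsBoundedOn (N c t) (chartSupport (d := d) c) := by
    intro c t ht
    refine ContinuousOn.isBoundedOn ?_ (isCompact_chartSupport c)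
      (isCompact_chartSupport c).measurableSet
    refine (continuousOn_comp_symm_chartSupport
      (chartPartition (d := d) S c).contMDiff.continuous c).mul (ContinuousOn.mul ?_
      (continuousOn_comp_symm_chartSupport (hF.comp (hcont t ht)) c))
    exact ((contDiffOn_gramDet g h.smooth c).continuousOn.comp
      ((hγ c).continuousOn.comp (f := fun x ↦ (t, x)) (by fun_prop)
        fun x hx ↦ ⟨ht, chartSupport_subset c hx⟩)
      fun x hx ↦ hγmaps c ⟨ht, chartSupport_subset c hx⟩).sqrt
  have hmain : ∀ c, HasDerivWithinAt (fun t ↦ ∫ x in chartSupport (d := d) c, N c t x)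
      (∫ x in chartSupport (d := d) c,
        chartPartition (d := d) S c ((extChartAt (𝓡∂ d) c).symm x) *
        (areaDensityDeriv g Φ ε c x
            ((ψ ((extChartAt (𝓡∂ d) c).symm x), 0), chartDeriv c ψ x) *
            F (Φ 0 ((extChartAt (𝓡∂ d) c).symm x)) +
          areaDensity g Φ ε c x * w ((extChartAt (𝓡∂ d) c).symm x))) (Ioi 0) 0 := by
    intro c
    have hsub : chartSupport (d := d) c ⊆ range (𝓡∂ d) :=
      (chartSupport_subset c).trans (extChartAt_target_subset_range c)
    obtain ⟨C₁, hC₁0, hC₁⟩ := exists_eventually_abs_sub_le (𝓡∂ d).convex_range hsub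
      (isCompact_chartSupport c) (G := fun z ↦ Real.sqrt (gramDet g Φ ε c (γ c z)))
      fun x hx ↦ by
        have hxt := chartSupport_subset c hx
        refine ContDiffWithinAt.mono_of_mem_nhdsWithin ?_ (timeChart_mem_nhdsWithin hδ hxt)
        refine ContDiffWithinAt.sqrt ?_ (by rw [hγ0]; exact (h.gramDet_pos hxt).ne')
        exact (((contDiffOn_gramDet g h.smooth c).comp (hγ c) (hγmaps c)) (0, x)
          ⟨h0δ, hxt⟩).of_le (by exact_mod_cast le_top)
    obtain ⟨C₂, hC₂0, hC₂⟩ := exists_eventually_abs_sub_le (𝓡∂ d).convex_range hsub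
      (isCompact_chartSupport c) (G := fun z ↦ F₀ (readInChart Φ c (γ c z).1))
      fun x hx ↦ by
        have hxt := chartSupport_subset c hx
        refine ContDiffWithinAt.mono_of_mem_nhdsWithin ?_ (timeChart_mem_nhdsWithin hδ hxt)
        have h1 : ContDiffOn ℝ 1 (F₀ ∘ readInChart (d := d) Φ c) (timeChart ε c) :=
          contMDiffOn_iff_contDiffOn.1 (hF₀.comp_contMDiffOn
            ((contMDiffOn_readInChart h.smooth c).of_le (by exact_mod_cast le_top)))
        exact (h1.comp ((contDiff_fst.comp_contDiffOn (hγ c)).of_le (by exact_mod_cast le_top))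
          fun z hz ↦ (hγmaps c hz).1) (0, x) ⟨h0δ, hxt⟩
    obtain ⟨Bs, hBs⟩ := (isCompact_chartSupport (d := d) c).exists_bound_of_continuousOn
      ((h.continuousOn_areaDensity c).mono (chartSupport_subset c))
    obtain ⟨Bf, hBf⟩ := (isBoundedOn_comp_symm (d := d) (hF.comp (hcont 0 h0δ)) c).exists_bound
    refine hasDerivWithinAt_setIntegral_Ioi (C := C₁ * (Bf + C₂) + Bs * C₂)
      (isCompact_chartSupport c)
      (isCompact_chartSupport c).measurableSet ?_ (hbdd c 0 h0δ) ?_ fun x hx ↦ ?_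
    · exact mem_nhdsWithin_of_mem_nhds (mem_of_superset hnhds (hbdd c))
    · filter_upwards [mem_nhdsWithin_of_mem_nhds hC₁, mem_nhdsWithin_of_mem_nhds hC₂,
        mem_nhdsWithin_of_mem_nhds (Ioo_mem_nhds (by norm_num : (-1 : ℝ) < 0) one_pos)]
        with t h1 h2 ht1 x hx
      replace h1 := h1 x hx
      replace h2 := (hFF₀ _ _).trans (h2 x hx)
      have hBs' := hBs x hx
      have hBf' := hBf x hx
      simp only [hγ0] at h1
      simp only [readInChart, γ, zero_mul] at h2
      simp only [N, hγ0, zero_mul]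
      simp only [Function.comp_apply, zero_mul, Real.norm_eq_abs] at hBs' hBf'
      change |areaDensity g Φ ε c x| ≤ Bs at hBs'
      change |_ - areaDensity g Φ ε c x| ≤ _ at h1
      change |_ * _ - _ * (areaDensity g Φ ε c x * _)| ≤ _
      set A₀ := areaDensity g Φ ε c x
      set A := Real.sqrt (gramDet g Φ ε c (γ c (t, x)))
      set p := (extChartAt (𝓡∂ d) c).symm x
      have ht : |t| ≤ 1 := (abs_lt.2 ht1).le
      have hFt : |F (Φ (t * ψ p) p)| ≤ Bf + C₂ := by
        have e1 := abs_sub_abs_le_abs_sub (F (Φ (t * ψ p) p)) (F (Φ 0 p))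
        have e2 : C₂ * |t| ≤ C₂ := mul_le_of_le_one_right hC₂0 ht
        linarith
      have e : chartPartition (d := d) S c p * (A * F (Φ (t * ψ p) p)) -
          chartPartition (d := d) S c p * (A₀ * F (Φ 0 p)) =
          chartPartition (d := d) S c p * ((A - A₀) * F (Φ (t * ψ p) p) +
            A₀ * (F (Φ (t * ψ p) p) - F (Φ 0 p))) := by ring
      rw [e, abs_mul, abs_of_nonneg ((chartPartition (d := d) S).nonneg c p)]
      refine (mul_le_of_le_one_left (abs_nonneg _)
        ((chartPartition (d := d) S).le_one c p)).trans ((abs_add_le _ _).trans ?_)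
      rw [abs_mul, abs_mul]
      have e1 := mul_le_mul h1 hFt (abs_nonneg _) (by positivity)
      have e2 := mul_le_mul hBs' h2 (abs_nonneg _) ((abs_nonneg _).trans hBs')
      calc _ ≤ C₁ * |t| * (Bf + C₂) + Bs * (C₂ * |t|) := add_le_add e1 e2
        _ = _ := by ring
    · have hxt := chartSupport_subset c hx
      set p := (extChartAt (𝓡∂ d) c).symm x
      have hcurve : HasDerivWithinAt (fun t : ℝ ↦ γ c (t, x)) ((ψ p, 0), chartDeriv c ψ x)
          (Ioo (-δ) δ) 0 := by
        have e1 := (hasDerivWithinAt_id (0 : ℝ) (Ioo (-δ) δ)).mul_const (ψ p)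
        have e2 := (hasDerivWithinAt_id (0 : ℝ) (Ioo (-δ) δ)).smul_const (chartDeriv c ψ x)
        rw [one_mul] at e1
        rw [one_smul] at e2
        exact (e1.prodMk (hasDerivWithinAt_const 0 _ x)).prodMk e2
      have harea : HasDerivAt (fun t : ℝ ↦ Real.sqrt (gramDet g Φ ε c (γ c (t, x))))
          (areaDensityDeriv g Φ ε c x ((ψ p, 0), chartDeriv c ψ x)) 0 :=
        (HasFDerivWithinAt.comp_hasDerivWithinAt_of_eq (0 : ℝ)
          (h.hasFDerivWithinAt_sqrt_gramDet hxt) hcurve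
          (fun t ht ↦ hγmaps c (⟨ht, hxt⟩ : (t, x) ∈ timeChart δ c))
          (hγ0 c x).symm).hasDerivAt hnhds
      have hprod := (harea.hasDerivWithinAt.mul (hw p)).const_mul (chartPartition (d := d) S c p)
      simp only [hγ0, zero_mul] at hprod
      exact hprod
  refine (HasDerivWithinAt.fun_sum fun c _ ↦ hmain c).congr_of_eventuallyEq ?_ (hWN 0 h0δ)
  exact mem_nhdsWithin_of_mem_nhds (mem_of_superset hnhds hWN)

end Variation

/-! ### Integrals over the zero set of the integrand -/

section ZeroSet

variable {d : ℕ} [NeZero d] {S : Type*} [TopologicalSpace S]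
  [ChartedSpace (EuclideanHalfSpace d) S] [IsManifold (𝓡∂ d) ∞ S] [CompactSpace S] [T2Space S]

/-- The integral of `k` over the zero set of `f`, with weight `m` in the charts. -/
def zeroSetIntegral (f : S → ℝ) (m : S → EuclideanSpace ℝ (Fin d) → ℝ) (k : S → ℝ) : ℝ :=
  ∑ c ∈ partitionIndex d S, ∫ x in chartSupport (d := d) c,
    m c x * if f ((extChartAt (𝓡∂ d) c).symm x) = 0 then k ((extChartAt (𝓡∂ d) c).symm x) else 0

variable {f k k' : S → ℝ} {m : S → EuclideanSpace ℝ (Fin d) → ℝ}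

theorem isBoundedOn_ite_zero (hf : Continuous f) (hk : Continuous k) (c : S) :
    IsBoundedOn (fun x ↦ if f ((extChartAt (𝓡∂ d) c).symm x) = 0 then
      k ((extChartAt (𝓡∂ d) c).symm x) else 0) (chartSupport (d := d) c) := by
  -- The indicator of the zero set is `1 - (sign f)²`.
  have h1 : IsBoundedOn (fun x ↦ Real.sign (f ((extChartAt (𝓡∂ d) c).symm x)))
      (chartSupport (d := d) c) := (isBoundedOn_comp_symm hf c).real_sign
  have h2 := (isBoundedOn_comp_symm (d := d) hk c).add
    ((isBoundedOn_comp_symm (d := d) hk.neg c).mul (h1.mul h1))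
  refine ⟨h2.1.congr (ae_of_all _ fun x ↦ ?_), ?_⟩
  · dsimp only [Pi.neg_apply]
    generalize f ((extChartAt (𝓡∂ d) c).symm x) = y
    generalize k ((extChartAt (𝓡∂ d) c).symm x) = z
    rcases lt_trichotomy y 0 with h | h | h
    · simp [Real.sign_of_neg h, h.ne]
    · simp [h]
    · simp [Real.sign_of_pos h, h.ne']
  · obtain ⟨C, hC⟩ := (isBoundedOn_comp_symm (d := d) hk c).exists_bound
    refine ⟨C, fun x hx ↦ ?_⟩
    split_ifs
    · exact hC x hx
    · simpa using (norm_nonneg _).trans (hC x hx)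

theorem integrableOn_zeroSetIntegral_integrand (hf : Continuous f) (hk : Continuous k) {c : S}
    (hm : IsBoundedOn (m c) (chartSupport (d := d) c)) :
    IntegrableOn (fun x ↦ m c x * if f ((extChartAt (𝓡∂ d) c).symm x) = 0 then
      k ((extChartAt (𝓡∂ d) c).symm x) else 0) (chartSupport (d := d) c) :=
  (hm.mul (isBoundedOn_ite_zero hf hk c)).integrableOn (isCompact_chartSupport c)
    (isCompact_chartSupport c).measurableSet

theorem zeroSetIntegral_add (hf : Continuous f) (hk : Continuous k) (hk' : Continuous k')
    (hm : ∀ c, IsBoundedOn (m c) (chartSupport (d := d) c)) :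
    zeroSetIntegral f m (fun p ↦ k p + k' p) = zeroSetIntegral f m k + zeroSetIntegral f m k' := by
  unfold zeroSetIntegral
  rw [← Finset.sum_add_distrib]
  refine Finset.sum_congr rfl fun c _ ↦ ?_
  rw [← integral_add (integrableOn_zeroSetIntegral_integrand hf hk (hm c))
    (integrableOn_zeroSetIntegral_integrand hf hk' (hm c))]
  refine integral_congr_ae (ae_of_all _ fun x ↦ ?_)
  dsimp only
  split_ifs <;> ring

theorem zeroSetIntegral_const_mul (r : ℝ) :
    zeroSetIntegral f m (fun p ↦ r * k p) = r * zeroSetIntegral f m k := by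
  unfold zeroSetIntegral
  rw [Finset.mul_sum]
  refine Finset.sum_congr rfl fun c _ ↦ ?_
  rw [← integral_const_mul]
  refine integral_congr_ae (ae_of_all _ fun x ↦ ?_)
  dsimp only
  split_ifs <;> ring

theorem zeroSetIntegral_mono (hf : Continuous f) (hk : Continuous k) (hk' : Continuous k')
    (hm : ∀ c, IsBoundedOn (m c) (chartSupport (d := d) c))
    (hm0 : ∀ c, ∀ x ∈ chartSupport (d := d) c, 0 ≤ m c x) (h : ∀ p, k p ≤ k' p) :
    zeroSetIntegral f m k ≤ zeroSetIntegral f m k' := by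
  refine Finset.sum_le_sum fun c _ ↦ setIntegral_mono_on
    (integrableOn_zeroSetIntegral_integrand hf hk (hm c))
    (integrableOn_zeroSetIntegral_integrand hf hk' (hm c))
    (isCompact_chartSupport c).measurableSet fun x hx ↦ mul_le_mul_of_nonneg_left ?_ (hm0 c x hx)
  split_ifs
  · exact h _
  · exact le_rfl

/-- If a nonnegative function integrates to zero over the zero set of `f`, then so does every
function that vanishes with it. -/
theorem zeroSetIntegral_eq_zero_of_nonneg (hf : Continuous f) (hk : Continuous k)
    (hm : ∀ c, IsBoundedOn (m c) (chartSupport (d := d) c))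
    (hm0 : ∀ c, ∀ x ∈ chartSupport (d := d) c, 0 ≤ m c x) (hk0 : ∀ p, 0 ≤ k p)
    (h : zeroSetIntegral f m k = 0) (hkk' : ∀ p, k p = 0 → k' p = 0) :
    zeroSetIntegral f m k' = 0 := by
  have hnn : ∀ c, ∀ x ∈ chartSupport (d := d) c, 0 ≤ m c x *
      if f ((extChartAt (𝓡∂ d) c).symm x) = 0 then k ((extChartAt (𝓡∂ d) c).symm x) else 0 := by
    intro c x hx
    refine mul_nonneg (hm0 c x hx) ?_
    split_ifs
    · exact hk0 _
    · exact le_rfl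
  refine Finset.sum_eq_zero fun c hc ↦ ?_
  have hKm := (isCompact_chartSupport (d := d) c).measurableSet
  have h1 := (Finset.sum_eq_zero_iff_of_nonneg
    fun c _ ↦ setIntegral_nonneg (isCompact_chartSupport c).measurableSet (hnn c)).1 h c hc
  have h2 := (setIntegral_eq_zero_iff_of_nonneg_ae
    ((ae_restrict_iff' hKm).2 (ae_of_all _ (hnn c)))
    (integrableOn_zeroSetIntegral_integrand hf hk (hm c))).1 h1
  refine integral_eq_zero_of_ae ?_
  filter_upwards [h2] with x hx
  simp only [Pi.zero_apply, mul_eq_zero, ite_eq_right_iff] at hx ⊢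
  exact hx.imp_right fun h h0 ↦ hkk' _ (h h0)

/-- The fundamental lemma of the calculus of variations on the zero set of `f`. -/
theorem zeroSetIntegral_mul_self_eq_zero (hf : Continuous f) {v : S → ℝ} (hv : Continuous v)
    (hm : ∀ c, IsBoundedOn (m c) (chartSupport (d := d) c))
    (hm0 : ∀ c, ∀ x ∈ chartSupport (d := d) c, 0 ≤ m c x)
    (h : ∀ ψ : S → ℝ, ContMDiff (𝓡∂ d) 𝓘(ℝ, ℝ) ∞ ψ →
      zeroSetIntegral f m (fun p ↦ ψ p * v p) = 0) :
    zeroSetIntegral f m (fun p ↦ v p * v p) = 0 := by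
  have hzero : zeroSetIntegral f m (fun _ ↦ (0 : ℝ)) = 0 := by
    simp only [zeroSetIntegral, ite_self, mul_zero, integral_zero, Finset.sum_const_zero]
  have hle : ∀ δ > 0, zeroSetIntegral f m (fun p ↦ v p * v p) ≤
      δ * zeroSetIntegral f m (fun p ↦ |v p|) := by
    intro δ hδ
    obtain ⟨ψ, hψ⟩ := exists_contMDiffMap_forall_mem_convex_of_local_const (𝓡∂ d) (n := ⊤)
      (t := fun p ↦ Metric.ball (v p) δ) (fun p ↦ convex_ball _ _) fun p ↦
        ⟨v p, by
          filter_upwards [hv.continuousAt.eventually (Metric.ball_mem_nhds (v p) hδ)] with q hq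
          rwa [Metric.mem_ball']⟩
    have hψc : Continuous ψ := ψ.contMDiff.continuous
    have h1 : zeroSetIntegral f m (fun p ↦ v p * v p) =
        zeroSetIntegral f m (fun p ↦ (v p - ψ p) * v p) := by
      have := zeroSetIntegral_add (k := fun p ↦ (v p - ψ p) * v p) (k' := fun p ↦ ψ p * v p) hf
        ((hv.sub hψc).mul hv) (hψc.mul hv) hm
      rw [h ψ ψ.contMDiff, add_zero] at this
      rw [← this]
      congr 1
      ext p
      ring
    rw [h1, ← zeroSetIntegral_const_mul]
    refine zeroSetIntegral_mono hf ((hv.sub hψc).mul hv) (continuous_const.mul hv.abs) hm hm0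
      fun p ↦ (le_abs_self _).trans ?_
    rw [abs_mul]
    refine mul_le_mul_of_nonneg_right ?_ (abs_nonneg _)
    have := hψ p
    rw [Metric.mem_ball'] at this
    exact this.le
  have hB : 0 ≤ zeroSetIntegral f m (fun p ↦ |v p|) := by
    rw [← hzero]
    exact zeroSetIntegral_mono hf continuous_const hv.abs hm hm0 fun p ↦ abs_nonneg _
  refine le_antisymm (le_of_forall_pos_le_add fun δ hδ ↦ ?_) ?_
  · refine (hle (δ / (zeroSetIntegral f m (fun p ↦ |v p|) + 1)) (by positivity)).trans ?_
    rw [zero_add, div_mul_eq_mul_div, div_le_iff₀ (by positivity)]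
    nlinarith
  · rw [← hzero]
    exact zeroSetIntegral_mono hf continuous_const (hv.mul hv) hm hm0 fun p ↦ mul_self_nonneg _

/-- Multiplying the coefficients of a functional twice by the sign of `f` removes exactly the
contribution of the zero set of `f`. -/
theorem testFunctional_eq_sign_sign_add (hf : Continuous f)
    {a : S → EuclideanSpace ℝ (Fin d) → ℝ}
    (ha : ∀ c, IsBoundedOn (a c) (chartSupport (d := d) c))
    {b : S → EuclideanSpace ℝ (Fin d) → ((EuclideanSpace ℝ (Fin d) →L[ℝ] ℝ) →L[ℝ] ℝ)}
    (hb : ∀ c, IsBoundedOn (b c) (chartSupport (d := d) c))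
    (hm : ∀ c, IsBoundedOn (m c) (chartSupport (d := d) c)) {v : S → ℝ} (hv : Continuous v)
    (ham : ∀ c x, f ((extChartAt (𝓡∂ d) c).symm x) = 0 →
      a c x = m c x * v ((extChartAt (𝓡∂ d) c).symm x))
    {ψ : S → ℝ} (hψ : ContMDiff (𝓡∂ d) 𝓘(ℝ, ℝ) ∞ ψ) :
    testFunctional f a b ψ =
      testFunctional f (fun c x ↦ Real.sign (f ((extChartAt (𝓡∂ d) c).symm x)) *
          (Real.sign (f ((extChartAt (𝓡∂ d) c).symm x)) * a c x))
        (fun c x ↦ Real.sign (f ((extChartAt (𝓡∂ d) c).symm x)) •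
          Real.sign (f ((extChartAt (𝓡∂ d) c).symm x)) • b c x) ψ +
      zeroSetIntegral f m (fun p ↦ ψ p * v p) := by
  unfold testFunctional zeroSetIntegral
  rw [← Finset.sum_add_distrib]
  refine Finset.sum_congr rfl fun c _ ↦ ?_
  have hs : IsBoundedOn (fun x ↦ Real.sign (f ((extChartAt (𝓡∂ d) c).symm x)))
      (chartSupport (d := d) c) := (isBoundedOn_comp_symm hf c).real_sign
  refine Eq.trans ?_ (integral_add ((isBoundedOn_testFunctional_integrand hf
    (hs.mul (hs.mul (ha c))) (hs.smul (hs.smul (hb c))) hψ).integrableOn (isCompact_chartSupport c)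
    (isCompact_chartSupport c).measurableSet)
    (integrableOn_zeroSetIntegral_integrand hf (hψ.continuous.mul hv) (hm c)))
  refine integral_congr_ae (ae_of_all _ fun x ↦ ?_)
  have hx := ham c x
  dsimp only
  set p := (extChartAt (𝓡∂ d) c).symm x
  rcases lt_trichotomy (f p) 0 with h | h | h
  · simp [Real.sign_of_neg h, h.ne]
  · simp only [h, Real.sign_zero, zero_mul, mul_zero, add_zero, if_true, zero_add, hx h]
    ring
  · simp [Real.sign_of_pos h, h.ne']

theorem testFunctional_neg {a : S → EuclideanSpace ℝ (Fin d) → ℝ}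
    {b : S → EuclideanSpace ℝ (Fin d) → ((EuclideanSpace ℝ (Fin d) →L[ℝ] ℝ) →L[ℝ] ℝ)}
    {ψ : S → ℝ} (hψ : ContMDiff (𝓡∂ d) 𝓘(ℝ, ℝ) ∞ ψ) :
    testFunctional f a b (fun p ↦ -ψ p) = -testFunctional f a b ψ := by
  unfold testFunctional
  rw [← Finset.sum_neg_distrib]
  refine Finset.sum_congr rfl fun c _ ↦ ?_
  rw [← integral_neg]
  refine setIntegral_congr_fun (isCompact_chartSupport c).measurableSet fun x hx ↦ ?_
  have hxt := chartSupport_subset c hx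
  have : chartDeriv c (fun p ↦ -ψ p) x = -chartDeriv c ψ x :=
    chartDeriv_eq_of_hasFDerivWithinAt hxt
      (hasFDerivWithinAt_chartDeriv (n := ⊤) le_top hψ c hxt).neg
  simp only [this, map_neg]
  ring

end ZeroSet

/-! ### Equality of the extrema -/

section Main

variable {d : ℕ} [NeZero d] {M : Type*} [TopologicalSpace M]
  [ChartedSpace (EuclideanHalfSpace (d + 1)) M] [IsManifold (𝓡∂ (d + 1)) ∞ M]
  {S : Type*} [TopologicalSpace S] [ChartedSpace (EuclideanHalfSpace d) S]
  [IsManifold (𝓡∂ d) ∞ S] [CompactSpace S] [T2Space S]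

/-- The area element of the undeformed surface, weighted by the partition of unity. -/
def areaWeight (g : LorentzianMetric d M) (Φ : ℝ → S → M) (ε : ℝ) (c : S)
    (x : EuclideanSpace ℝ (Fin d)) : ℝ :=
  chartPartition (d := d) S c ((extChartAt (𝓡∂ d) c).symm x) * areaDensity g Φ ε c x

/-- The coefficient of `ψ` in the first variation of `∫ √h F` along the deformation with its time
multiplied by `ψ`. -/
def variationCoeff (g : LorentzianMetric d M) (F : M → ℝ) (Φ : ℝ → S → M) (ε : ℝ) (c : S)
    (x : EuclideanSpace ℝ (Fin d)) : ℝ :=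
  chartPartition (d := d) S c ((extChartAt (𝓡∂ d) c).symm x) *
    (areaDensityDeriv g Φ ε c x ((1, 0), 0) * F (Φ 0 ((extChartAt (𝓡∂ d) c).symm x)) +
      areaDensity g Φ ε c x * velocity F Φ ((extChartAt (𝓡∂ d) c).symm x))

/-- The coefficient of `F dψ` in the first variation of `∫ √h F` along the deformation with its time
multiplied by `ψ`. -/
def tiltCoeff (g : LorentzianMetric d M) (Φ : ℝ → S → M) (ε : ℝ) (c : S)
    (x : EuclideanSpace ℝ (Fin d)) : (EuclideanSpace ℝ (Fin d) →L[ℝ] ℝ) →L[ℝ] ℝ :=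
  chartPartition (d := d) S c ((extChartAt (𝓡∂ d) c).symm x) •
    (areaDensityDeriv g Φ ε c x).comp (ContinuousLinearMap.inr ℝ
      (ℝ × EuclideanSpace ℝ (Fin d)) (EuclideanSpace ℝ (Fin d) →L[ℝ] ℝ))

namespace IsSpacelikeDeformation

variable {g : LorentzianMetric d M} {Φ : ℝ → S → M} {ε : ℝ}

theorem isBoundedOn_areaWeight (h : IsSpacelikeDeformation g Φ ε) (c : S) :
    IsBoundedOn (areaWeight g Φ ε c) (chartSupport (d := d) c) :=
  (isBoundedOn_comp_symm (chartPartition (d := d) S c).contMDiff.continuous c).mul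
    (((h.continuousOn_areaDensity c).mono (chartSupport_subset c)).isBoundedOn
      (isCompact_chartSupport c) (isCompact_chartSupport c).measurableSet)

theorem areaWeight_nonneg (h : IsSpacelikeDeformation g Φ ε) {c : S}
    {x : EuclideanSpace ℝ (Fin d)} (hx : x ∈ chartSupport (d := d) c) :
    0 ≤ areaWeight g Φ ε c x :=
  mul_nonneg ((chartPartition (d := d) S).nonneg c _)
    (h.areaDensity_pos (chartSupport_subset c hx)).le

theorem isBoundedOn_areaDensityDeriv (h : IsSpacelikeDeformation g Φ ε) (c : S) :
    IsBoundedOn (areaDensityDeriv g Φ ε c) (chartSupport (d := d) c) :=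
  ((h.continuousOn_areaDensityDeriv c).mono (chartSupport_subset c)).isBoundedOn
    (isCompact_chartSupport c) (isCompact_chartSupport c).measurableSet

theorem isBoundedOn_variationCoeff (h : IsSpacelikeDeformation g Φ ε) {F : M → ℝ}
    (hF : ContMDiff (𝓡∂ (d + 1)) 𝓘(ℝ, ℝ) 1 F) (c : S) :
    IsBoundedOn (variationCoeff g F Φ ε c) (chartSupport (d := d) c) :=
  (isBoundedOn_comp_symm (chartPartition (d := d) S c).contMDiff.continuous c).mul
    ((((h.isBoundedOn_areaDensityDeriv c).clm_apply (.const _)).mul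
      (isBoundedOn_comp_symm (h.contMDiff_comp_zero hF).continuous c)).add
    ((((h.continuousOn_areaDensity c).mono (chartSupport_subset c)).isBoundedOn
      (isCompact_chartSupport c) (isCompact_chartSupport c).measurableSet).mul
      (isBoundedOn_comp_symm (continuous_velocity hF h.pos h.smooth) c)))

theorem isBoundedOn_tiltCoeff (h : IsSpacelikeDeformation g Φ ε) (c : S) :
    IsBoundedOn (tiltCoeff g Φ ε c) (chartSupport (d := d) c) := by
  have h1 : IsBoundedOn (fun x ↦ (areaDensityDeriv g Φ ε c x).comp (ContinuousLinearMap.inr ℝ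
      (ℝ × EuclideanSpace ℝ (Fin d)) (EuclideanSpace ℝ (Fin d) →L[ℝ] ℝ)))
      (chartSupport (d := d) c) :=
    (((h.continuousOn_areaDensityDeriv c).mono (chartSupport_subset c)).clm_comp
      continuousOn_const).isBoundedOn (isCompact_chartSupport c)
      (isCompact_chartSupport c).measurableSet
  exact IsBoundedOn.smul
    (isBoundedOn_comp_symm (chartPartition (d := d) S c).contMDiff.continuous c) h1

theorem hasDerivWithinAt_surfaceFunctional_self (h : IsSpacelikeDeformation g Φ ε) {F : M → ℝ}
    (hF : ContMDiff (𝓡∂ (d + 1)) 𝓘(ℝ, ℝ) 1 F) {ψ : S → ℝ}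
    (hψ : ContMDiff (𝓡∂ d) 𝓘(ℝ, ℝ) ∞ ψ) :
    HasDerivWithinAt (fun t ↦ surfaceFunctional g F (fun p ↦ Φ (t * ψ p) p))
      (testFunctional (fun p ↦ F (Φ 0 p)) (variationCoeff g F Φ ε) (tiltCoeff g Φ ε) ψ)
      (Ioi 0) 0 := by
  refine (h.hasDerivWithinAt_surfaceFunctional hF hF.continuous (fun _ _ ↦ le_rfl) hψ
    fun p ↦ (h.hasDerivAt_comp_reparametrize hF ψ p).hasDerivWithinAt).congr_deriv ?_
  refine Finset.sum_congr rfl fun c _ ↦ integral_congr_ae (ae_of_all _ fun x ↦ ?_)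
  dsimp only [variationCoeff, tiltCoeff]
  rw [areaDensityDeriv_apply, _root_.smul_apply, ContinuousLinearMap.comp_apply,
    ContinuousLinearMap.inr_apply, smul_eq_mul]
  ring

theorem hasDerivWithinAt_surfaceFunctional_abs (h : IsSpacelikeDeformation g Φ ε) {F : M → ℝ}
    (hF : ContMDiff (𝓡∂ (d + 1)) 𝓘(ℝ, ℝ) 1 F) {ψ : S → ℝ}
    (hψ : ContMDiff (𝓡∂ d) 𝓘(ℝ, ℝ) ∞ ψ) :
    HasDerivWithinAt (fun t ↦ surfaceFunctional g (fun y ↦ |F y|) (fun p ↦ Φ (t * ψ p) p))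
      (testFunctional (fun p ↦ F (Φ 0 p))
          (fun c x ↦ Real.sign (F (Φ 0 ((extChartAt (𝓡∂ d) c).symm x))) *
            variationCoeff g F Φ ε c x)
          (fun c x ↦ Real.sign (F (Φ 0 ((extChartAt (𝓡∂ d) c).symm x))) • tiltCoeff g Φ ε c x) ψ +
        zeroSetIntegral (fun p ↦ F (Φ 0 p)) (areaWeight g Φ ε)
          (fun p ↦ |ψ p * velocity F Φ p|)) (Ioi 0) 0 := by
  have hf := (h.contMDiff_comp_zero hF).continuous
  have hv := continuous_velocity hF h.pos h.smooth
  refine (h.hasDerivWithinAt_surfaceFunctional hF hF.continuous.abs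
    (fun _ _ ↦ abs_abs_sub_abs_le_abs_sub _ _) hψ
    fun p ↦ hasDerivWithinAt_abs_Ioi (h.hasDerivAt_comp_reparametrize hF ψ p)).congr_deriv ?_
  unfold testFunctional zeroSetIntegral
  rw [← Finset.sum_add_distrib]
  refine Finset.sum_congr rfl fun c _ ↦ ?_
  have hs : IsBoundedOn (fun x ↦ Real.sign (F (Φ 0 ((extChartAt (𝓡∂ d) c).symm x))))
      (chartSupport (d := d) c) := (isBoundedOn_comp_symm hf c).real_sign
  refine Eq.trans ?_ (integral_add ((isBoundedOn_testFunctional_integrand hf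
    (hs.mul (h.isBoundedOn_variationCoeff hF c)) (hs.smul (h.isBoundedOn_tiltCoeff c))
    hψ).integrableOn (isCompact_chartSupport c) (isCompact_chartSupport c).measurableSet)
    (integrableOn_zeroSetIntegral_integrand hf (hψ.continuous.mul hv).abs
      (h.isBoundedOn_areaWeight c)))
  refine integral_congr_ae (ae_of_all _ fun x ↦ ?_)
  dsimp only [variationCoeff, tiltCoeff, areaWeight]
  rw [areaDensityDeriv_apply, _root_.smul_apply, _root_.smul_apply,
    ContinuousLinearMap.comp_apply, ContinuousLinearMap.inr_apply, smul_eq_mul, smul_eq_mul,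
    zero_mul]
  set p := (extChartAt (𝓡∂ d) c).symm x
  have habs : |F (Φ 0 p)| = Real.sign (F (Φ 0 p)) * F (Φ 0 p) := by
    rcases lt_trichotomy (F (Φ 0 p)) 0 with h | h | h
    · rw [Real.sign_of_neg h, abs_of_neg h, neg_one_mul]
    · simp [h]
    · rw [Real.sign_of_pos h, abs_of_pos h, one_mul]
  rw [habs]
  ring

end IsSpacelikeDeformation

theorem hasDerivAt_zero_of_hasDerivWithinAt_Ioi {u : ℝ → ℝ}
    (h : HasDerivWithinAt u 0 (Ioi 0) 0) (h' : HasDerivWithinAt (fun t ↦ u (-t)) 0 (Ioi 0) 0) :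
    HasDerivAt u 0 0 := by
  rw [← hasDerivWithinAt_univ, ← Iic_union_Ici (a := (0 : ℝ))]
  refine HasDerivWithinAt.union ?_ (hasDerivWithinAt_Ioi_iff_Ici.1 h)
  rw [← hasDerivWithinAt_Iio_iff_Iic]
  have h1 : HasDerivWithinAt (fun t : ℝ ↦ -t) (-1) (Iio 0) 0 := (hasDerivAt_neg 0).hasDerivWithinAt
  have hm : MapsTo (fun t : ℝ ↦ -t) (Iio 0) (Ioi 0) := fun t ht ↦ by simpa using ht
  rw [← neg_zero] at h'
  simpa [Function.comp_def] using HasDerivWithinAt.comp (0 : ℝ) h' h1 (by simpa using hm)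

theorem Extremizes.eq_zero {g : LorentzianMetric d M} {F : M → ℝ} {X : S → M}
    (hE : Extremizes g F X) {Φ : ℝ → S → M} (hΦ : IsVariation d X Φ) {ψ : S → ℝ}
    (hψ : ContMDiff (𝓡∂ d) 𝓘(ℝ, ℝ) ∞ ψ) {r : ℝ}
    (hr : HasDerivWithinAt (fun t ↦ surfaceFunctional g F (fun p ↦ Φ (t * ψ p) p)) r (Ioi 0) 0) :
    r = 0 :=
  (uniqueDiffWithinAt_Ioi 0).eq_deriv _ hr (hE _ (hΦ.reparametrize hψ)).hasDerivWithinAt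

theorem hasDerivAt_surfaceFunctional_zero {g : LorentzianMetric d M} {F : M → ℝ} {Φ : ℝ → S → M}
    (h : ∀ r : ℝ, HasDerivWithinAt
      (fun t ↦ surfaceFunctional g F (fun p : S ↦ Φ (t * r) p)) 0 (Ioi 0) 0) :
    HasDerivAt (fun t ↦ surfaceFunctional g F (Φ t)) 0 0 :=
  hasDerivAt_zero_of_hasDerivWithinAt_Ioi (by simpa using h 1) (by simpa using h (-1))

/-- The sign lemma, applied twice, shows that the velocity of `F` vanishes almost everywhere on the
zero set of `F` on the surface, so that `|F|` is differentiable along the deformation there. -/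
theorem Extremizes.abs {g : LorentzianMetric d M} {T : TimeOrientation g} {σ : Set M}
    {F : M → ℝ} (hF : ContMDiff (𝓡∂ (d + 1)) 𝓘(ℝ, ℝ) 1 F) {X : S → M}
    (hX : IsAnchoredCauchySurface g T σ X) (hE : Extremizes g F X) :
    Extremizes g (fun y ↦ |F y|) X := by
  intro Φ hΦ
  obtain ⟨ε, h⟩ := hΦ.exists_isSpacelikeDeformation hX
  have hf := h.contMDiff_comp_zero hF
  have hv := continuous_velocity hF h.pos h.smooth
  have ha := h.isBoundedOn_variationCoeff hF
  have hb := h.isBoundedOn_tiltCoeff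
  have hm := h.isBoundedOn_areaWeight
  have hm0 : ∀ c : S, ∀ x ∈ chartSupport (d := d) c, 0 ≤ areaWeight g Φ ε c x :=
    fun c x hx ↦ h.areaWeight_nonneg hx
  have hs : ∀ c, IsBoundedOn (fun x ↦ Real.sign (F (Φ 0 ((extChartAt (𝓡∂ d) c).symm x))))
      (chartSupport (d := d) c) := fun c ↦ (isBoundedOn_comp_symm hf.continuous c).real_sign
  have hA := fun (ψ : S → ℝ) (hψ : ContMDiff (𝓡∂ d) 𝓘(ℝ, ℝ) ∞ ψ) ↦
    hE.eq_zero hΦ hψ (h.hasDerivWithinAt_surfaceFunctional_self hF hψ)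
  have hB := fun (ψ : S → ℝ) (hψ : ContMDiff (𝓡∂ d) 𝓘(ℝ, ℝ) ∞ ψ) ↦
    testFunctional_sign_eq_zero hf ha hb hA (ψ := ψ) hψ
  have hC := fun (ψ : S → ℝ) (hψ : ContMDiff (𝓡∂ d) 𝓘(ℝ, ℝ) ∞ ψ) ↦
    testFunctional_sign_eq_zero hf (fun c ↦ (hs c).mul (ha c))
    (fun c ↦ (hs c).smul (hb c)) hB (ψ := ψ) hψ
  have hzero : ∀ ψ : S → ℝ, ContMDiff (𝓡∂ d) 𝓘(ℝ, ℝ) ∞ ψ →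
      zeroSetIntegral (fun p ↦ F (Φ 0 p)) (areaWeight g Φ ε)
        (fun p ↦ ψ p * velocity F Φ p) = 0 := by
    intro ψ hψ
    have := testFunctional_eq_sign_sign_add hf.continuous ha hb hm hv
      (fun c x hx ↦ by simp only [variationCoeff, areaWeight, hx]; ring) hψ
    rw [hA ψ hψ, hC ψ hψ, zero_add] at this
    exact this.symm
  have hvv := zeroSetIntegral_mul_self_eq_zero hf.continuous hv hm hm0 hzero
  refine hasDerivAt_surfaceFunctional_zero fun r ↦ ?_
  refine (h.hasDerivWithinAt_surfaceFunctional_abs hF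
    (contMDiff_const (c := r))).congr_deriv ?_
  rw [hB _ contMDiff_const, zero_add]
  exact zeroSetIntegral_eq_zero_of_nonneg hf.continuous (hv.mul hv) hm hm0
    (fun p ↦ mul_self_nonneg _) hvv fun p hp ↦ by simp [mul_self_eq_zero.1 hp]

/-- The existence of a two-sided derivative for `|F|` forces the velocity of `F` to vanish almost
everywhere on the zero set of `F` on the surface; multiplying by the sign of `F` once more then
recovers the first variation for `F`. -/
theorem Extremizes.of_abs {g : LorentzianMetric d M} {T : TimeOrientation g} {σ : Set M}
    {F : M → ℝ} (hF : ContMDiff (𝓡∂ (d + 1)) 𝓘(ℝ, ℝ) 1 F) {X : S → M}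
    (hX : IsAnchoredCauchySurface g T σ X) (hE : Extremizes g (fun y ↦ |F y|) X) :
    Extremizes g F X := by
  intro Φ hΦ
  obtain ⟨ε, h⟩ := hΦ.exists_isSpacelikeDeformation hX
  have hf := h.contMDiff_comp_zero hF
  have hv := continuous_velocity hF h.pos h.smooth
  have ha := h.isBoundedOn_variationCoeff hF
  have hb := h.isBoundedOn_tiltCoeff
  have hm := h.isBoundedOn_areaWeight
  have hm0 : ∀ c : S, ∀ x ∈ chartSupport (d := d) c, 0 ≤ areaWeight g Φ ε c x :=
    fun c x hx ↦ h.areaWeight_nonneg hx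
  have hs : ∀ c, IsBoundedOn (fun x ↦ Real.sign (F (Φ 0 ((extChartAt (𝓡∂ d) c).symm x))))
      (chartSupport (d := d) c) := fun c ↦ (isBoundedOn_comp_symm hf.continuous c).real_sign
  have hR := fun (ψ : S → ℝ) (hψ : ContMDiff (𝓡∂ d) 𝓘(ℝ, ℝ) ∞ ψ) ↦
    hE.eq_zero hΦ hψ (h.hasDerivWithinAt_surfaceFunctional_abs hF hψ)
  -- The sum is zero for `ψ = 1` and `ψ = -1`; its first term is odd in `ψ` and its second is even.
  have hvabs : zeroSetIntegral (fun p ↦ F (Φ 0 p)) (areaWeight g Φ ε)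
      (fun p ↦ |velocity F Φ p|) = 0 := by
    have h1 := hR (fun _ ↦ 1) contMDiff_const
    have h2 := hR (fun _ ↦ -1) contMDiff_const
    rw [testFunctional_neg (ψ := fun _ ↦ 1) contMDiff_const] at h2
    simp only [one_mul, neg_one_mul, abs_neg] at h1 h2
    linarith
  have hnull : ∀ k : S → ℝ, (∀ p, velocity F Φ p = 0 → k p = 0) →
      zeroSetIntegral (fun p ↦ F (Φ 0 p)) (areaWeight g Φ ε) k = 0 := fun k hk ↦
    zeroSetIntegral_eq_zero_of_nonneg hf.continuous hv.abs hm hm0 (fun p ↦ abs_nonneg _) hvabs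
      fun p hp ↦ hk p (abs_eq_zero.1 hp)
  have hB : ∀ ψ : S → ℝ, ContMDiff (𝓡∂ d) 𝓘(ℝ, ℝ) ∞ ψ → testFunctional (fun p ↦ F (Φ 0 p))
      (fun c x ↦ Real.sign (F (Φ 0 ((extChartAt (𝓡∂ d) c).symm x))) * variationCoeff g F Φ ε c x)
      (fun c x ↦ Real.sign (F (Φ 0 ((extChartAt (𝓡∂ d) c).symm x))) • tiltCoeff g Φ ε c x) ψ =
        0 := by
    intro ψ hψ
    have := hR ψ hψ
    rwa [hnull (fun p ↦ |ψ p * velocity F Φ p|) fun p hp ↦ by simp [hp], add_zero] at this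
  have hC := fun (ψ : S → ℝ) (hψ : ContMDiff (𝓡∂ d) 𝓘(ℝ, ℝ) ∞ ψ) ↦
    testFunctional_sign_eq_zero hf (fun c ↦ (hs c).mul (ha c))
    (fun c ↦ (hs c).smul (hb c)) hB (ψ := ψ) hψ
  refine hasDerivAt_surfaceFunctional_zero fun r ↦ ?_
  refine (h.hasDerivWithinAt_surfaceFunctional_self hF
    (contMDiff_const (c := r))).congr_deriv ?_
  rw [testFunctional_eq_sign_sign_add hf.continuous ha hb hm hv
      (fun c x hx ↦ by simp only [variationCoeff, areaWeight, hx]; ring) contMDiff_const,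
    hC _ contMDiff_const, hnull _ fun p hp ↦ by simp [hp], add_zero]

end Main

end CauchyExtremal

end

theorem theorem2 {d : ℕ} [NeZero d]
    {M : Type*} [TopologicalSpace M] [T2Space M] [SecondCountableTopology M]
    [ChartedSpace (EuclideanHalfSpace (d + 1)) M] [IsManifold (𝓡∂ (d + 1)) ∞ M]
    (g : CauchyExtremal.LorentzianMetric d M) (T : CauchyExtremal.TimeOrientation g)
    (σ : Set M) (hσ : CauchyExtremal.IsCauchyIn g T ((𝓡∂ (d + 1)).boundary M) σ)
    (F₂ : M → ℝ) (hF₂ : ContMDiff (𝓡∂ (d + 1)) 𝓘(ℝ, ℝ) 1 F₂)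
    {S : Type*} [TopologicalSpace S] [T2Space S] [CompactSpace S]
    [ChartedSpace (EuclideanHalfSpace d) S] [IsManifold (𝓡∂ d) ∞ S]
    (X : S → M) (hX : CauchyExtremal.IsAnchoredCauchySurface g T σ X) :
    CauchyExtremal.Extremizes g F₂ X ↔ CauchyExtremal.Extremizes g (fun x ↦ |F₂ x|) X :=
  ⟨fun h ↦ h.abs hF₂ hX, fun h ↦ h.of_abs hF₂ hX⟩
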